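/- \textbf{Setting.} Let $\mathcal M\subset\mathbb R^{2\nu}$ be open and connected, let $S^{+},S^{-}\subset\mathcal M$ be relatively closed, and let $T:\mathcal M\setminus S^{+}\to\mathcal M\setminus S^{-}$ be a $C^1$ diffeomorphism; $T^n$ ($n\in\mathbb Z$) is regarded as a partially defined map, and $T^iS^{-}$ is the set of points $T^iw$ with $w\in S^-$ in the domain of $T^i$. Let $\mathcal C$ be a field of closed cones $\mathcal C(z)\subset\mathbb R^{2\nu}$, $z\in\mathcal M$ (closed sets containing $0$ and invariant under multiplication by real numbers). For $z$ in the domain of $T^{-n}$ put $\mathcal C_n(z)=DT^n_{T^{-n}z}\,\mathcal C(T^{-n}z)$; for $z\in S^{-}$ let $\mathcal C_1(z)$ be the set of all limits of vectors $v_k\in\mathcal C_1(w_k)$ with $w_k\in\mathcal M\setminus S^{-}$, $w_k\to z$. An unstable curve is a $C^1$ curve $\gamma:[0,1]\to\mathcal M$ with $\gamma'(t)\in\mathcal C_1(\gamma(t))$ for all $t$; $d^u(x,y)$ is the infimum of the lengths of the unstable curves joining $x$ and $y$ ($\infty$ if there are none), $d^u(z,A)=\inf_{a\in A}d^u(z,a)$,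 and $A_{[\varepsilon]}=\{z\in\mathcal M: d^u(z,A)\le\varepsilon\}$. A compact set is regular if it is a finite union of pieces of $C^1$ codimension-one submanifolds, each piece being the closure of its interior in its submanifold, the pieces overlapping at most on their boundaries, and the boundary of each piece being a finite union of compact subsets of codimension-two submanifolds. A set $A$ is regular near $z$ if $A\cap V$ is regular for some neighbourhood $V$ of $z$. \textbf{Assumptions.} (1) $\partial\mathcal M$ is regular near every point of $\mathbb R^{2\nu}$; $\mathcal M$ carries a $C^1$ symplectic form $\omega$, whose symplectic volume is denoted by $\mu$ ($\mu(\mathcal M)=\infty$ is allowed). (2) $T$ preserves $\omega$ and is recurrent: for every measurable $A\subset\mathcal M$, $\mu$-almost every point of $A$ returns to $A$. (3) $\mathcal C$ is continuous on $\mathcal M\setminus S^{+}$, $DT_z\mathcal C(z)\subset\mathcal C(Tz)$ for all $z\in\mathcal M\setminus S^+$, and for $\mu$-a.e. $z$ there is $n\ge1$ with $DT^n_z\mathcal C(z)\subset\operatorname{int}\mathcal C(T^nz)\cup\{0\}$. (4) For all $n$ the sets $\bigcup_{i<n}T^{-i}S^{+}$ and $\bigcup_{i<n}T^{i}S^{-}$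 are regular near every point of $\mathcal M$. (5) There is a finite measure $\pi$ on $S^{-}$, absolutely continuous with respect to the hypersurface measure induced by $\mu$ on $S^{-}$, such that $\limsup_{\varepsilon\to0^+}\mu(A_{[\varepsilon]})/\varepsilon\le\pi(A)$ for every relatively closed $A\subset S^{-}$. (6) At every point $z$ near which $S^{+}$ (respectively $S^{-}$) is a codimension-one submanifold, the $\omega$-orthogonal complement of its tangent space is contained in the closure of $\mathbb R^{2\nu}\setminus\mathcal C(z)$ (respectively in $\mathcal C(z)$). (7) Every $z_0\in\mathcal M$ has a neighbourhood $U_0$, an $\varepsilon_0>0$ and a $K>0$ such that $|DT^n_wv|\ge K|v|$ whenever $w\in S^{-}_{[\varepsilon_0]}$, $n>0$, $T^nw$ is defined and lies in $U_0$, and $v\in\mathcal C_1(w)$. (8) There are norms $\|v\|_z$ for the cone vectors $v\in\mathcal C(z)$, depending continuously on $(z,v)$ and locally equivalent to the Euclidean norm $|\cdot|$, and numbers $\kappa(z)>1$, with $\|DT_zv\|_{Tz}\ge\kappa(z)\|v\|_z$ for all $z\in\mathcal M\setminus S^{+}$ and $v\in\mathcal C(z)$, where $\kappa$ is bounded away from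 $1$ near each point of $\mathcal M$; and for $\pi$-a.e. $z\in S^{-}$ all $T^n$, $n\ge0$, are defined at $z$ and $$\lim_{n\to+\infty}\ \inf_{0\ne v\in\mathcal C_1(z)}\frac{\|DT^n_zv\|_{T^nz}}{\|v\|_z}=+\infty .$$ A local unstable manifold at $z$ is an open embedded $C^1$ disk $W\ni z$ such that every $w\in W$ has an infinite backward orbit with $|T^{-n}w-T^{-n}z|\to0$ as $n\to\infty$, and the tangent space of $W$ at $w$ is contained in $\bigcap_n\mathcal C_n(w)$ and has the maximal dimension of a subspace there. Write $\partial W=\overline W\setminus W$. We say that $W$ has radius less than $\delta$ because it is cut by a set $B$ if some $C^1$ curve of length less than $\delta$ starts at $z$, lies in $W$ except for its endpoint, and ends at a point of $\partial W\cap B$. \textbf{Lemma (tail bound).} Under these assumptions, for every $z_0\in\mathcal M$ there are a neighbourhood $U$ of $z_0$ and a $\delta_0>0$ such that for every $\eta>0$ there is $M\in\mathbb N$ with $$\mu\Bigl(\Bigl\{z\in U:\ \text{some local unstable manifold at } z \text{ has radius}<\delta\text{ because it is cut by }\bigcup_{i=M+1}^{\infty}T^iS^{-}\Bigr\}\Bigr)\le\eta\,\delta\qquad\text{for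 all }0<\delta\le\delta_0 ,$$ where $\mu$ of a set is its outer measure. -/

import Mathlib

open Set Filter Topology MeasureTheory
open scoped ENNReal

/-! ### Regular sets in a Euclidean space -/

/-- `N` is an (embedded, `C¹`) submanifold of codimension `k`: locally the zero set of a
submersion with values in `ℝᵏ`. -/
def IsSubmanifoldOfCodim {E : Type*} [NormedAddCommGroup E] [NormedSpace ℝ E]
    (k : ℕ) (N : Set E) : Prop :=
  ∀ x ∈ N, ∃ U : Set E, IsOpen U ∧ x ∈ U ∧ ∃ f : E → (Fin k → ℝ),
    ContDiffOn ℝ 1 f U ∧ (∀ y ∈ U, Function.Surjective (fderiv ℝ f y)) ∧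
    N ∩ U = {y ∈ U | f y = 0}

/-- The interior of `P` in the topology of `N`. -/
def relInterior {E : Type*} [TopologicalSpace E] (N P : Set E) : Set E :=
  {x ∈ P | ∃ U ∈ 𝓝 x, N ∩ U ⊆ P}

/-- A compact set that is a finite union of pieces `P i` of codimension-one submanifolds `N i`,
where (a) `P i` is the closure of its interior, in the topology of `N i`; (b) different pieces
overlap at most on their boundaries; (c) the boundary of each piece is a finite union of compact
subsets of codimension-two submanifolds.  (As `P i` is closed in `N i`, its boundary in `N i` is
`P i \ relInterior (N i) (P i)`.) -/
def IsRegularSet {E : Type*} [NormedAddCommGroup E] [NormedSpace ℝ E] (A : Set E) : Prop :=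
  IsCompact A ∧ ∃ (n : ℕ) (N P : Fin n → Set E),
    A = ⋃ i, P i ∧
    (∀ i, IsSubmanifoldOfCodim 1 (N i) ∧ P i ⊆ N i ∧
      P i = N i ∩ closure (relInterior (N i) (P i))) ∧
    (∀ i j, i ≠ j → P i ∩ P j ⊆
      (P i \ relInterior (N i) (P i)) ∩ (P j \ relInterior (N j) (P j))) ∧
    (∀ i, ∃ (m : ℕ) (Q B : Fin m → Set E),
      (∀ l, IsSubmanifoldOfCodim 2 (Q l) ∧ B l ⊆ Q l ∧ IsCompact (B l)) ∧
      P i \ relInterior (N i) (P i) = ⋃ l, B l)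

/-- `A` is regular near every point of `O`. -/
def IsLocallyRegularOn {E : Type*} [NormedAddCommGroup E] [NormedSpace ℝ E]
    (A O : Set E) : Prop :=
  ∀ z ∈ O, ∃ U ∈ 𝓝 z, IsRegularSet (A ∩ U)

/-! ### Curves -/

/-- The length of a `C¹` curve parametrized by `[0, 1]`. -/
noncomputable def curveLength {E : Type*} [NormedAddCommGroup E] [NormedSpace ℝ E]
    (γ : ℝ → E) : ℝ≥0∞ :=
  ∫⁻ t in Icc (0 : ℝ) 1, ‖derivWithin γ (Icc (0 : ℝ) 1) t‖ₑ

/-! ### The dynamical system -/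

/-- The Euclidean space `ℝ^{2ν}`. -/
abbrev Sp (ν : ℕ) : Type := EuclideanSpace ℝ (Fin (2 * ν))

/-- The data of a symplectic map with singularities, together with a field of (unstable) cones.
The conditions on these data are the predicates that follow. -/
structure SingularSystem (ν : ℕ) where
  /-- the phase space -/
  M : Set (Sp ν)
  /-- the singularity set of the map -/
  Splus : Set (Sp ν)
  /-- the singularity set of the inverse map -/
  Sminus : Set (Sp ν)
  /-- the map, defined on `T.source`, with its inverse, defined on `T.target` -/
  T : OpenPartialHomeomorph (Sp ν) (Sp ν)
  /-- the symplectic form -/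
  ω : Sp ν → (Sp ν) [⋀^Fin 2]→L[ℝ] ℝ
  /-- the cone field -/
  cone : Sp ν → Set (Sp ν)

namespace SingularSystem

variable {ν : ℕ}

/-- The density of the symplectic volume with respect to Lebesgue measure: the absolute value of
the Pfaffian of the matrix of `ω`, which is the square root of its determinant. -/
noncomputable def volumeDensity (S : SingularSystem ν) (z : Sp ν) : ℝ :=
  Real.sqrt |(Matrix.of fun i j : Fin (2 * ν) =>
    S.ω z ![EuclideanSpace.single i 1, EuclideanSpace.single j 1]).det|

/-- The symplectic volume on the phase space. -/
noncomputable def μ (S : SingularSystem ν) : Measure (Sp ν) :=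
  (volume.restrict S.M).withDensity fun z => ENNReal.ofReal (S.volumeDensity z)

/-- The domain of `Tⁿ`. -/
def dom (S : SingularSystem ν) (n : ℕ) : Set (Sp ν) :=
  {z ∈ S.M | ∀ j < n, S.T^[j] z ∈ S.T.source}

/-- The domain of `T⁻ⁿ`. -/
def bwdDom (S : SingularSystem ν) (n : ℕ) : Set (Sp ν) :=
  {z ∈ S.M | ∀ j < n, S.T.symm^[j] z ∈ S.T.target}

/-- `Tⁿ S⁻`, the image of the part of `S⁻` where `Tⁿ` is defined. -/
def imageSminus (S : SingularSystem ν) (n : ℕ) : Set (Sp ν) :=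
  S.T^[n] '' (S.Sminus ∩ S.dom n)

/-- `T⁻ⁿ S⁺`. -/
def preimageSplus (S : SingularSystem ν) (n : ℕ) : Set (Sp ν) :=
  S.T.symm^[n] '' (S.Splus ∩ S.bwdDom n)

/-- The differential of `Tⁿ`. -/
noncomputable def D (S : SingularSystem ν) (n : ℕ) (z : Sp ν) : Sp ν →L[ℝ] Sp ν :=
  fderiv ℝ (S.T^[n]) z

/-- The `n`-th nested cone at a point `z` where `T⁻ⁿ` is defined. -/
def nestedCone (S : SingularSystem ν) (n : ℕ) (z : Sp ν) : Set (Sp ν) :=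
  S.D n (S.T.symm^[n] z) '' S.cone (S.T.symm^[n] z)

/-- The first nested cone.  At a point of `S⁻`, where `T⁻¹` is not defined, it consists of all
limits of vectors of the first nested cones at points outside `S⁻` that tend to the point. -/
def coneOne (S : SingularSystem ν) (z : Sp ν) : Set (Sp ν) :=
  {v | (z ∉ S.Sminus ∧ v ∈ S.nestedCone 1 z) ∨
    (z ∈ S.Sminus ∧
      (z, v) ∈ closure {p : Sp ν × Sp ν | p.1 ∈ S.T.target ∧ p.2 ∈ S.nestedCone 1 p.1})}

/-- A `C¹` curve from `x` to `y` in the phase space, with tangent vectors in the first nested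
cones. -/
structure IsUnstableCurve (S : SingularSystem ν) (γ : ℝ → Sp ν) (x y : Sp ν) : Prop where
  contDiffOn : ContDiffOn ℝ 1 γ (Icc 0 1)
  start : γ 0 = x
  finish : γ 1 = y
  mem : ∀ t ∈ Icc (0 : ℝ) 1, γ t ∈ S.M
  tangent : ∀ t ∈ Icc (0 : ℝ) 1, derivWithin γ (Icc 0 1) t ∈ S.coneOne (γ t)

/-- The unstable distance of two points, `∞` if no unstable curve joins them. -/
noncomputable def unstableDist (S : SingularSystem ν) (x y : Sp ν) : ℝ≥0∞ :=
  ⨅ (γ : ℝ → Sp ν) (_ : S.IsUnstableCurve γ x y), curveLength γ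

/-- The closed tubular neighbourhood of `A`, of radius `ε`, in the unstable distance. -/
def tube (S : SingularSystem ν) (A : Set (Sp ν)) (ε : ℝ) : Set (Sp ν) :=
  {z ∈ S.M | (⨅ a ∈ A, S.unstableDist z a) ≤ ENNReal.ofReal ε}

/-! ### The conditions -/

/-- Phase space: open, connected, with locally regular boundary and a symplectic form. -/
structure PhaseSpaceCondition (S : SingularSystem ν) : Prop where
  isOpen : IsOpen S.M
  isConnected : IsConnected S.M
  boundary : IsLocallyRegularOn (frontier S.M) univ
  form_contDiffOn : ContDiffOn ℝ 1 S.ω S.M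
  form_closed : ∀ z ∈ S.M, extDeriv S.ω z = 0
  form_nondegenerate : ∀ z ∈ S.M, ∀ v, v ≠ 0 → ∃ u, S.ω z ![v, u] ≠ 0

/-- Map: an invertible, recurrent, `C¹` map of `M \ S⁺` onto `M \ S⁻` that preserves the
symplectic form. -/
structure MapCondition (S : SingularSystem ν) : Prop where
  Splus_subset : S.Splus ⊆ S.M
  Sminus_subset : S.Sminus ⊆ S.M
  source_eq : S.T.source = S.M \ S.Splus
  target_eq : S.T.target = S.M \ S.Sminus
  contDiffOn : ContDiffOn ℝ 1 S.T S.T.source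
  contDiffOn_symm : ContDiffOn ℝ 1 S.T.symm S.T.target
  symplectic : ∀ z ∈ S.T.source, ∀ u v,
    S.ω (S.T z) ![S.D 1 z u, S.D 1 z v] = S.ω z ![u, v]
  recurrent : ∀ A ⊆ S.M, MeasurableSet A →
    ∀ᵐ z ∂S.μ, z ∈ A → ∃ n, 0 < n ∧ z ∈ S.dom n ∧ S.T^[n] z ∈ A

/-- Cone bundle: closed cones, invariant and eventually strictly invariant under the map, that
vary continuously where the map is defined. -/
structure ConeCondition (S : SingularSystem ν) : Prop where
  isClosed : ∀ z ∈ S.M, IsClosed (S.cone z)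
  zero_mem : ∀ z ∈ S.M, (0 : Sp ν) ∈ S.cone z
  smul_mem : ∀ z ∈ S.M, ∀ v ∈ S.cone z, ∀ t : ℝ, t • v ∈ S.cone z
  continuous : ∀ z ∈ S.T.source, ∀ ε > 0, ∀ᶠ w in 𝓝 z,
    (∀ v ∈ S.cone w, ‖v‖ = 1 → ∃ u ∈ S.cone z, ‖u - v‖ < ε) ∧
    (∀ v ∈ S.cone z, ‖v‖ = 1 → ∃ u ∈ S.cone w, ‖u - v‖ < ε)
  invariant : ∀ z ∈ S.T.source, S.D 1 z '' S.cone z ⊆ S.cone (S.T z)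
  eventually_strict : ∀ᵐ z ∂S.μ, ∃ n, 0 < n ∧ z ∈ S.dom n ∧
    S.D n z '' S.cone z ⊆ interior (S.cone (S.T^[n] z)) ∪ {0}

/-- Local regularity of the singularity sets of all powers of the map. -/
def RegularityCondition (S : SingularSystem ν) : Prop :=
  ∀ n : ℕ, IsLocallyRegularOn (⋃ i < n, S.preimageSplus i) S.M ∧
    IsLocallyRegularOn (⋃ i < n, S.imageSminus i) S.M

/-- The measure that `μ` and the distance induce on `S⁻`. -/
noncomputable def surfaceMeasure (S : SingularSystem ν) : Measure (Sp ν) :=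
  ((Measure.hausdorffMeasure (2 * (ν : ℝ) - 1)).restrict S.Sminus).withDensity
    fun z => ENNReal.ofReal (S.volumeDensity z)

/-- Measure of tubular neighbourhoods: `π` is a finite measure on `S⁻`, absolutely continuous with
respect to the induced measure, and `limsup μ(A_[ε]) / ε ≤ π(A)` as `ε → 0⁺`, for every relatively
closed subset `A = S⁻ ∩ F` of `S⁻`. -/
structure TubeCondition (S : SingularSystem ν) (π : Measure (Sp ν)) : Prop where
  finite : π univ < ∞
  supported : π S.Sminusᶜ = 0
  absolutelyContinuous : π ≪ S.surfaceMeasure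
  tube_le : ∀ F : Set (Sp ν), IsClosed F → ∀ h : ℝ, 0 < h → ∀ᶠ ε : ℝ in 𝓝[>] 0,
    S.μ (S.tube (S.Sminus ∩ F) ε) ≤ (π (S.Sminus ∩ F) + ENNReal.ofReal h) * ENNReal.ofReal ε

/-- `H` is the tangent space at `z` of a set `A` that is a codimension-one submanifold near `z`. -/
def IsTangentHyperplane (A : Set (Sp ν)) (z : Sp ν) (H : Submodule ℝ (Sp ν)) : Prop :=
  ∃ U : Set (Sp ν), IsOpen U ∧ z ∈ U ∧ ∃ f : Sp ν → ℝ, ContDiffOn ℝ 1 f U ∧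
    (∀ y ∈ U, fderiv ℝ f y ≠ 0) ∧ A ∩ U = {y ∈ U | f y = 0} ∧
    H = LinearMap.ker (fderiv ℝ f z : Sp ν →ₗ[ℝ] ℝ)

/-- The skew-orthogonal complement of `H` with respect to the symplectic form at `z`. -/
def skewComplement (S : SingularSystem ν) (z : Sp ν) (H : Submodule ℝ (Sp ν)) : Set (Sp ν) :=
  {v | ∀ u ∈ H, S.ω z ![v, u] = 0}

/-- Proper alignment: the characteristic lines of `S⁺` lie in the complementary cones, those of
`S⁻` in the cones. -/
def AlignmentCondition (S : SingularSystem ν) : Prop :=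
  (∀ z ∈ S.Splus, ∀ H, IsTangentHyperplane S.Splus z H →
    S.skewComplement z H ⊆ closure (S.cone z)ᶜ) ∧
  (∀ z ∈ S.Sminus, ∀ H, IsTangentHyperplane S.Sminus z H → S.skewComplement z H ⊆ S.cone z)

/-- Non-contraction around the singularity set. -/
def NonContractionCondition (S : SingularSystem ν) : Prop :=
  ∀ z₀ ∈ S.M, ∃ U₀ ∈ 𝓝 z₀, ∃ ε₀ > 0, ∃ K > 0,
    ∀ w ∈ S.tube S.Sminus ε₀, ∀ n > 0, w ∈ S.dom n → S.T^[n] w ∈ U₀ →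
      ∀ v ∈ S.coneOne w, K * ‖v‖ ≤ ‖S.D n w v‖

/-- `N z v` is a (continuous) norm for cone vectors `v ∈ cone z`, locally equivalent to the
Euclidean norm, that is increased by the map by factors `κ z > 1`, and there is no point of the
phase space near which the factors are not bounded away from `1`. -/
structure IsIncreasingNorm (S : SingularSystem ν) (N : Sp ν → Sp ν → ℝ) : Prop where
  smul : ∀ z ∈ S.M, ∀ v ∈ S.cone z, ∀ t : ℝ, N z (t • v) = |t| * N z v
  add_le : ∀ z ∈ S.M, ∀ u ∈ S.cone z, ∀ v ∈ S.cone z, u + v ∈ S.cone z →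
    N z (u + v) ≤ N z u + N z v
  continuousOn : ContinuousOn (fun p : Sp ν × Sp ν => N p.1 p.2)
    {p | p.1 ∈ S.M ∧ p.2 ∈ S.cone p.1}
  locally_equivalent : ∀ z ∈ S.M, ∃ a > 0, ∃ b > 0, ∀ᶠ w in 𝓝 z,
    ∀ v ∈ S.cone w, a * ‖v‖ ≤ N w v ∧ N w v ≤ b * ‖v‖
  increasing : ∃ κ : Sp ν → ℝ,
    (∀ z ∈ S.T.source, 1 < κ z ∧ ∀ v ∈ S.cone z, κ z * N z v ≤ N (S.T z) (S.D 1 z v)) ∧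
    {z ∈ S.M | ∃ x : ℕ → Sp ν, (∀ n, x n ∈ S.T.source) ∧ Tendsto x atTop (𝓝 z) ∧
      Tendsto (fun n => κ (x n)) atTop (𝓝 1)} = ∅

/-- Sinai–Chernov Ansatz for the norm `N`: at almost every point `z` of `S⁻` all powers of the map
are defined, and the infimum of `‖D Tⁿ v‖ / ‖v‖` over `0 ≠ v ∈ coneOne z` tends to `+∞`. -/
def SinaiChernovAnsatz (S : SingularSystem ν) (π : Measure (Sp ν)) (N : Sp ν → Sp ν → ℝ) : Prop :=
  ∀ᵐ z ∂π, z ∈ S.Sminus → (∀ n, z ∈ S.dom n) ∧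
    ∀ R : ℝ, ∀ᶠ n in atTop, ∀ v ∈ S.coneOne z, R * N z v ≤ N (S.T^[n] z) (S.D n z v)

/-! ### Local unstable manifolds -/

/-- `W` is a local unstable manifold at `z`: a `C¹` (open, embedded) disk through `z`, of some
dimension `d`, whose points have infinite backward orbits asymptotic to that of `z`, and whose
tangent spaces lie in the nested cones of all orders and have the maximal dimension there.  Neither
uniqueness nor maximality of `W` is required, so that every choice of a local unstable manifold at
`z`, in particular the one prolonged as far as possible, is among these sets. -/
def IsLocalUnstableManifold (S : SingularSystem ν) (z : Sp ν) (W : Set (Sp ν)) : Prop :=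
  z ∈ W ∧ ∃ (d : ℕ) (φ : EuclideanSpace ℝ (Fin d) → Sp ν),
    ContDiff ℝ 1 φ ∧ IsEmbedding φ ∧ (∀ x, Function.Injective (fderiv ℝ φ x)) ∧ range φ = W ∧
    (∀ w ∈ W, (∀ n, w ∈ S.bwdDom n) ∧
      Tendsto (fun n : ℕ => ‖S.T.symm^[n] w - S.T.symm^[n] z‖) atTop (𝓝 0)) ∧
    (∀ x, (∀ n, range (fderiv ℝ φ x) ⊆ S.nestedCone n (φ x)) ∧
      ∀ V : Submodule ℝ (Sp ν), (∀ n, (V : Set (Sp ν)) ⊆ S.nestedCone n (φ x)) →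
        Module.finrank ℝ V ≤ d)

end SingularSystem

/-- The infimum of the lengths of the `C¹` curves in `W` that join `z` with a point of
`∂W ∩ B`, where `∂W = closure W \ W` is the boundary of the open disk `W`.  For `B = univ` this is
the radius of `W`; that it is smaller than `δ` means that `W` has radius less than `δ` because it
is cut by `B`. -/
noncomputable def radiusCutBy {E : Type*} [NormedAddCommGroup E] [NormedSpace ℝ E]
    (z : E) (W B : Set E) : ℝ≥0∞ :=
  ⨅ (γ : ℝ → E) (_ : ContDiffOn ℝ 1 γ (Icc 0 1) ∧ γ 0 = z ∧ (∀ t ∈ Ico (0 : ℝ) 1, γ t ∈ W) ∧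
    γ 1 ∈ (closure W \ W) ∩ B), curveLength γ

/-!
Fix a small ball `B` around `z₀` in which the norm `N` is comparable with the Euclidean norm and in
which each visit of an orbit expands the cone vectors by a factor `κ > 1`. Suppose that a local
unstable manifold at `z ∈ B` is cut by `Tⁱ S⁻` at a distance less than `δ`. The cutting curve,
pulled back by `T⁻ⁱ`, is an unstable curve from `w = T⁻ⁱ z` to `S⁻`. By the expansion between the
visits and the noncontraction property its length is at most `c δ κ⁻ᵏ`, where `k` is the number of
visits of the orbit of `w` to `B` before the time `i`, so `w` lies in the tube of that radius
around `S⁻`. For fixed `k`, the sets of points whose visit number `k` occurs at the time `i` are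
disjoint for distinct `i`. As `T` does not increase the measure, the bad points have measure at most
`∑ₖ μ(tube (c δ κ⁻ᵏ))`, a convergent series of order `δ`.

For a fixed `δ` the part of this sum with `i > m` thus tends to zero as `m → ∞`. For small `δ` the
constant in front of `δ` has to be made small as well: by the Sinai–Chernov Ansatz all late iterates
expand by a large factor `R` near each point of `S⁻` outside a closed set of small `π`-measure, so
`c` is small for the curves that end outside this set, and the tubes around it are thin.
-/

/-! ### Iterates of partially defined maps -/

section PartialIteration

variable {α : Type*} {f g : α → α} {s t M : Set α} {m n : ℕ} {x : α}

/-- The domain of the `n`-th iterate of the partial map of `M` that `f` defines on `s`. -/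
def iterateDomain (f : α → α) (s M : Set α) (n : ℕ) : Set α :=
  {x ∈ M | ∀ j < n, f^[j] x ∈ s}

lemma antitone_iterateDomain (f : α → α) (s M : Set α) : Antitone (iterateDomain f s M) :=
  fun _ _ hmn _ hx => ⟨hx.1, fun j hj => hx.2 j (hj.trans_le hmn)⟩

lemma mem_iterateDomain_succ :
    x ∈ iterateDomain f s M (n + 1) ↔ x ∈ iterateDomain f s M n ∧ f^[n] x ∈ s := by
  simp only [iterateDomain, mem_ofPred_eq, Nat.forall_lt_succ_right, and_assoc]

lemma iterate_mem_of_mem_iterateDomain (hf : MapsTo f s M) (hx : x ∈ iterateDomain f s M n) :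
    f^[n] x ∈ M := by
  cases n with
  | zero => exact hx.1
  | succ n =>
    rw [Function.iterate_succ_apply']
    exact hf (hx.2 n n.lt_succ_self)

lemma iterate_mem_iterateDomain (hf : MapsTo f s M) (hx : x ∈ iterateDomain f s M (m + n)) :
    f^[m] x ∈ iterateDomain f s M n := by
  refine ⟨iterate_mem_of_mem_iterateDomain hf
    (antitone_iterateDomain f s M (Nat.le_add_right m n) hx), fun j hj => ?_⟩
  rw [← Function.iterate_add_apply]
  exact hx.2 _ (by omega)

lemma leftInvOn_iterate (hg : LeftInvOn g f s) :
    LeftInvOn g^[n] f^[n] (iterateDomain f s M n) := by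
  intro x hx
  induction n with
  | zero => rfl
  | succ n ih =>
    obtain ⟨hx, hxs⟩ := mem_iterateDomain_succ.1 hx
    rw [Function.iterate_succ_apply, Function.iterate_succ_apply', hg hxs, ih hx]

lemma mapsTo_iterate (hf : MapsTo f s t) (htM : t ⊆ M) (hg : LeftInvOn g f s) :
    MapsTo f^[n] (iterateDomain f s M n) (iterateDomain g t M n) := by
  intro x hx
  refine ⟨iterate_mem_of_mem_iterateDomain (hf.mono_right htM) hx, fun j hj => ?_⟩
  obtain ⟨k, rfl⟩ := Nat.exists_eq_add_of_lt hj
  rw [show j + k + 1 = k + 1 + j by omega] at hx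
  rw [show j + k + 1 = j + (k + 1) by omega, Function.iterate_add_apply,
    leftInvOn_iterate hg (iterate_mem_iterateDomain (hf.mono_right htM) hx),
    Function.iterate_succ_apply']
  exact hf (hx.2 k (by omega))

lemma continuousOn_iterate [TopologicalSpace α] (hf : ContinuousOn f s) :
    ContinuousOn f^[n] (iterateDomain f s M n) := by
  induction n with
  | zero => exact continuousOn_id
  | succ n ih =>
    rw [Function.iterate_succ']
    exact hf.comp (ih.mono fun x hx => (mem_iterateDomain_succ.1 hx).1)
      fun x hx => (mem_iterateDomain_succ.1 hx).2

lemma isOpen_iterateDomain [TopologicalSpace α] (hM : IsOpen M) (hs : IsOpen s)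
    (hf : ContinuousOn f s) : IsOpen (iterateDomain f s M n) := by
  induction n with
  | zero => simpa [iterateDomain] using hM
  | succ n ih =>
    have h := (continuousOn_iterate (M := M) hf).isOpen_inter_preimage ih hs
    rwa [show iterateDomain f s M n ∩ f^[n] ⁻¹' s = iterateDomain f s M (n + 1) from
      ext fun x => mem_iterateDomain_succ.symm] at h

lemma contDiffOn_iterate {𝕜 E : Type*} [NontriviallyNormedField 𝕜] [NormedAddCommGroup E]
    [NormedSpace 𝕜 E] {f : E → E} {s M : Set E} {k : WithTop ℕ∞} (hf : ContDiffOn 𝕜 k f s) :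
    ContDiffOn 𝕜 k f^[n] (iterateDomain f s M n) := by
  induction n with
  | zero => exact contDiffOn_id
  | succ n ih =>
    rw [Function.iterate_succ']
    exact hf.comp (ih.mono fun x hx => (mem_iterateDomain_succ.1 hx).1)
      fun x hx => (mem_iterateDomain_succ.1 hx).2

end PartialIteration

lemma mem_range_of_hasDerivWithinAt_of_isEmbedding {𝕜 E F : Type*} [NontriviallyNormedField 𝕜]
    [NormedAddCommGroup E] [NormedSpace 𝕜 E] [NormedAddCommGroup F] [NormedSpace 𝕜 F]
    {φ : F → E} {L : F →L[𝕜] E} {x : F} {γ : 𝕜 → E} {v : E} {s : Set 𝕜} {t : 𝕜}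
    (hφ : IsEmbedding φ) (hφL : HasFDerivAt φ L x) (hL : L.HasLeftInverse)
    (hγ : HasDerivWithinAt γ v s t) (hs : UniqueDiffWithinAt 𝕜 s t) (hts : t ∈ s)
    (hxt : φ x = γ t) (hmem : ∀ u ∈ s, γ u ∈ range φ) : v ∈ range L := by
  choose! ξ hξ using hmem
  obtain rfl : ξ t = x := hφ.injective ((hξ t hts).trans hxt.symm)
  have hξcont : Tendsto ξ (𝓝[s] t) (𝓝[univ] (ξ t)) := by
    rw [nhdsWithin_univ, hφ.isInducing.nhds_eq_comap, tendsto_comap_iff, hxt]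
    exact hγ.continuousWithinAt.tendsto.congr'
      (eventually_nhdsWithin_of_forall fun u hu => (hξ u hu).symm)
  have hξdiff := HasFDerivWithinAt.of_comp_of_leftInverse hξcont hφL.hasFDerivWithinAt
    hγ.hasFDerivWithinAt (EqOn.eventuallyEq_of_mem hξ self_mem_nhdsWithin)
    hL.leftInverse_leftInverse hts
  have hφξ := (hφL.comp_hasDerivWithinAt t hξdiff.hasDerivWithinAt).congr
    (fun u hu => (hξ u hu).symm) (hξ t hts).symm
  exact ⟨_, hs.eq_deriv _ hφξ hγ⟩

/-! ### Lengths of curves -/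

section Curves

variable {E F : Type*} [NormedAddCommGroup E] [NormedSpace ℝ E] [NormedAddCommGroup F]
  [NormedSpace ℝ F] {γ σ : ℝ → E} {τ : ℝ → F} {s t u c r : ℝ}

/-- The length of the part of a `C¹` curve on `[0, 1]` between the times `s ≤ t`.  As in
`curveLength` the derivative is taken within `[0, 1]`, so that it is continuous up to the ends. -/
noncomputable def arcLength (γ : ℝ → E) (s t : ℝ) : ℝ :=
  ∫ u in s..t, ‖derivWithin γ (Icc 0 1) u‖

lemma continuousOn_norm_derivWithin (hγ : ContDiffOn ℝ 1 γ (Icc 0 1)) :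
    ContinuousOn (fun t => ‖derivWithin γ (Icc 0 1) t‖) (Icc 0 1) :=
  (hγ.continuousOn_derivWithin uniqueDiffOn_Icc_zero_one le_rfl).norm

lemma hasDerivWithinAt_of_contDiffOn (hγ : ContDiffOn ℝ 1 γ (Icc 0 1)) (ht : t ∈ Icc (0 : ℝ) 1) :
    HasDerivWithinAt γ (derivWithin γ (Icc 0 1) t) (Icc 0 1) t :=
  (hγ.differentiableOn one_ne_zero t ht).hasDerivWithinAt

lemma intervalIntegrable_norm_derivWithin (hγ : ContDiffOn ℝ 1 γ (Icc 0 1))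
    (hs : s ∈ Icc (0 : ℝ) 1) (ht : t ∈ Icc (0 : ℝ) 1) :
    IntervalIntegrable (fun t => ‖derivWithin γ (Icc 0 1) t‖) volume s t :=
  ((continuousOn_norm_derivWithin hγ).mono (uIcc_subset_Icc hs ht)).intervalIntegrable

lemma curveLength_eq_ofReal_arcLength (hγ : ContDiffOn ℝ 1 γ (Icc 0 1)) :
    curveLength γ = ENNReal.ofReal (arcLength γ 0 1) := by
  rw [arcLength, intervalIntegral.integral_of_le zero_le_one, ← integral_Icc_eq_integral_Ioc,
    ofReal_integral_eq_lintegral_ofReal (continuousOn_norm_derivWithin hγ).integrableOn_Icc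
      (ae_of_all _ fun _ => norm_nonneg _)]
  simp only [curveLength, ofReal_norm]

lemma arcLength_congr (h : EqOn γ σ (Icc 0 1)) (hs : 0 ≤ s) (hst : s ≤ t) (ht : t ≤ 1) :
    arcLength γ s t = arcLength σ s t :=
  intervalIntegral.integral_congr fun u hu => by
    rw [uIcc_of_le hst] at hu
    have hu01 : u ∈ Icc (0 : ℝ) 1 := Icc_subset_Icc hs ht hu
    simp only [derivWithin_congr h (h hu01)]

lemma arcLength_nonneg (hst : s ≤ t) : 0 ≤ arcLength γ s t :=
  intervalIntegral.integral_nonneg hst fun _ _ => norm_nonneg _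

lemma arcLength_mono (hγ : ContDiffOn ℝ 1 γ (Icc 0 1)) {s' t' : ℝ} (hs' : 0 ≤ s') (hs : s' ≤ s)
    (hst : s ≤ t) (ht : t ≤ t') (ht' : t' ≤ 1) : arcLength γ s t ≤ arcLength γ s' t' :=
  intervalIntegral.integral_mono_interval hs hst ht (ae_of_all _ fun _ => norm_nonneg _)
    (intervalIntegrable_norm_derivWithin hγ ⟨hs', by linarith⟩ ⟨by linarith, ht'⟩)

lemma arcLength_le_mul_arcLength (hσ : ContDiffOn ℝ 1 σ (Icc 0 1))
    (hτ : ContDiffOn ℝ 1 τ (Icc 0 1)) (hs : 0 ≤ s) (hst : s ≤ t) (ht : t ≤ 1) (hc : 0 ≤ c)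
    (h : ∀ u ∈ Icc s t, ‖derivWithin σ (Icc 0 1) u‖ ≤ c * ‖derivWithin τ (Icc 0 1) u‖) :
    arcLength σ s t ≤ c * arcLength τ 0 1 := by
  have hsI : s ∈ Icc (0 : ℝ) 1 := ⟨hs, hst.trans ht⟩
  have htI : t ∈ Icc (0 : ℝ) 1 := ⟨hs.trans hst, ht⟩
  calc arcLength σ s t ≤ ∫ u in s..t, c * ‖derivWithin τ (Icc 0 1) u‖ :=
        intervalIntegral.integral_mono_on hst (intervalIntegrable_norm_derivWithin hσ hsI htI)
          ((intervalIntegrable_norm_derivWithin hτ hsI htI).const_mul c) h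
    _ = c * arcLength τ s t := intervalIntegral.integral_const_mul _ _
    _ ≤ c * arcLength τ 0 1 := by gcongr; exact arcLength_mono hτ le_rfl hs hst ht le_rfl

lemma dist_le_arcLength [CompleteSpace E] (hγ : ContDiffOn ℝ 1 γ (Icc 0 1)) (hs : 0 ≤ s)
    (hst : s ≤ t) (ht : t ≤ 1) : dist (γ s) (γ t) ≤ arcLength γ s t := by
  have hsub : Icc s t ⊆ Icc 0 1 := Icc_subset_Icc hs ht
  have hderiv : ∀ u ∈ Ioo s t, HasDerivAt γ (derivWithin γ (Icc 0 1) u) u := fun u hu =>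
    (hasDerivWithinAt_of_contDiffOn hγ (hsub (Ioo_subset_Icc_self hu))).hasDerivAt
      (Icc_mem_nhds (hs.trans_lt hu.1) (hu.2.trans_le ht))
  have hcont : ContinuousOn (derivWithin γ (Icc 0 1)) (uIcc s t) := by
    rw [uIcc_of_le hst]
    exact (hγ.continuousOn_derivWithin uniqueDiffOn_Icc_zero_one le_rfl).mono hsub
  rw [dist_comm, dist_eq_norm, ← intervalIntegral.integral_eq_sub_of_hasDerivAt_of_le hst
    (hγ.continuousOn.mono hsub) hderiv hcont.intervalIntegrable]
  exact intervalIntegral.norm_integral_le_integral_norm hst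

lemma lineMap_mem_Icc_zero_one (hs : s ∈ Icc (0 : ℝ) 1) (hu : u ∈ Icc (0 : ℝ) 1) :
    AffineMap.lineMap s 1 u ∈ Icc (0 : ℝ) 1 :=
  (convex_Icc 0 1).lineMap_mem hs (right_mem_Icc.2 zero_le_one) hu

lemma derivWithin_comp_lineMap (hγ : ContDiffOn ℝ 1 γ (Icc 0 1)) (hs : s ∈ Icc (0 : ℝ) 1)
    (hu : u ∈ Icc (0 : ℝ) 1) :
    derivWithin (γ ∘ AffineMap.lineMap s 1) (Icc 0 1) u =
      (1 - s) • derivWithin γ (Icc 0 1) (AffineMap.lineMap s 1 u) :=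
  ((hasDerivWithinAt_of_contDiffOn hγ (lineMap_mem_Icc_zero_one hs hu)).scomp u
    AffineMap.hasDerivWithinAt_lineMap fun _ hx => lineMap_mem_Icc_zero_one hs hx).derivWithin
      (uniqueDiffOn_Icc_zero_one u hu)

lemma contDiffOn_comp_lineMap (hγ : ContDiffOn ℝ 1 γ (Icc 0 1)) (hs : s ∈ Icc (0 : ℝ) 1) :
    ContDiffOn ℝ 1 (γ ∘ AffineMap.lineMap (k := ℝ) s 1) (Icc 0 1) :=
  hγ.comp (AffineMap.contDiff_lineMap s 1).contDiffOn
    fun _ hu => lineMap_mem_Icc_zero_one hs hu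

lemma arcLength_comp_lineMap (hγ : ContDiffOn ℝ 1 γ (Icc 0 1)) (hs : s ∈ Icc (0 : ℝ) 1) :
    arcLength (γ ∘ AffineMap.lineMap s 1) 0 1 = arcLength γ s 1 := by
  have hderiv : ∀ u ∈ uIcc (0 : ℝ) 1, ‖derivWithin (γ ∘ AffineMap.lineMap s 1) (Icc 0 1) u‖ =
      (1 - s) * ‖derivWithin γ (Icc 0 1) (s + (1 - s) * u)‖ := by
    intro u hu
    rw [derivWithin_comp_lineMap hγ hs (by rwa [uIcc_of_le zero_le_one] at hu), norm_smul,
      Real.norm_of_nonneg (sub_nonneg.2 hs.2), AffineMap.lineMap_apply_ring']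
    ring_nf
  rw [arcLength, intervalIntegral.integral_congr hderiv, intervalIntegral.integral_const_mul,
    intervalIntegral.mul_integral_comp_add_mul (f := fun u => ‖derivWithin γ (Icc 0 1) u‖)]
  simp [arcLength]

lemma continuousOn_arcLength_right (hγ : ContDiffOn ℝ 1 γ (Icc 0 1)) :
    ContinuousOn (fun t => arcLength γ 0 t) (Icc 0 1) := by
  have hint := (continuousOn_norm_derivWithin hγ).integrableOn_Icc (μ := volume)
  simp only [arcLength]
  generalize (fun u => ‖derivWithin γ (Icc 0 1) u‖) = f at *
  rw [← uIcc_of_le zero_le_one] at hint ⊢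
  exact intervalIntegral.continuousOn_primitive_interval hint

lemma continuousOn_arcLength_left (hγ : ContDiffOn ℝ 1 γ (Icc 0 1)) :
    ContinuousOn (fun t => arcLength γ t 1) (Icc 0 1) := by
  have hint := (continuousOn_norm_derivWithin hγ).integrableOn_Icc (μ := volume)
  simp only [arcLength]
  generalize (fun u => ‖derivWithin γ (Icc 0 1) u‖) = f at *
  rw [← uIcc_of_le zero_le_one] at hint ⊢
  exact intervalIntegral.continuousOn_primitive_interval_left hint

lemma le_of_forall_lt_imp_le {X α : Type*} [TopologicalSpace X] [LinearOrder α]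
    [TopologicalSpace α] [OrderClosedTopology α] [DenselyOrdered α] {K : Set X} {f : X → α}
    {a b : α} (hK : IsPreconnected K) (hf : ContinuousOn f K) (hab : a < b)
    (h : ∀ x ∈ K, f x < b → f x ≤ a) {x₀ x : X} (hx₀ : x₀ ∈ K) (hfx₀ : f x₀ ≤ a) (hx : x ∈ K) :
    f x ≤ a := by
  by_contra! hax
  obtain ⟨m, ham, hmb⟩ := exists_between (lt_min hax hab)
  obtain ⟨y, hy, rfl⟩ := hK.intermediate_value hx₀ hx hf
    ⟨hfx₀.trans ham.le, (hmb.trans_le (min_le_left _ _)).le⟩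
  exact ham.not_ge (h y hy (hmb.trans_le (min_le_right _ _)))

lemma arcLength_le_of_forall_arcLength_right_lt (hσ : ContDiffOn ℝ 1 σ (Icc 0 1))
    (hτ : ContDiffOn ℝ 1 τ (Icc 0 1)) (hc : 0 ≤ c) (hr : c * arcLength τ 0 1 < r)
    (h : ∀ t ∈ Icc (0 : ℝ) 1, arcLength σ 0 t < r →
      ‖derivWithin σ (Icc 0 1) t‖ ≤ c * ‖derivWithin τ (Icc 0 1) t‖) :
    arcLength σ 0 1 ≤ c * arcLength τ 0 1 := by
  refine le_of_forall_lt_imp_le isPreconnected_Icc (continuousOn_arcLength_right hσ) hr ?_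
    (left_mem_Icc.2 zero_le_one) ?_ (right_mem_Icc.2 zero_le_one)
  · exact fun t ht hlt => arcLength_le_mul_arcLength hσ hτ le_rfl ht.1 ht.2 hc fun u hu =>
      h u ⟨hu.1, hu.2.trans ht.2⟩ ((arcLength_mono hσ le_rfl le_rfl hu.1 hu.2 ht.2).trans_lt hlt)
  · simpa [arcLength] using mul_nonneg hc (arcLength_nonneg (γ := τ) zero_le_one)

lemma arcLength_le_of_forall_arcLength_left_lt (hσ : ContDiffOn ℝ 1 σ (Icc 0 1))
    (hτ : ContDiffOn ℝ 1 τ (Icc 0 1)) (hc : 0 ≤ c) (hr : c * arcLength τ 0 1 < r)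
    (h : ∀ t ∈ Icc (0 : ℝ) 1, arcLength σ t 1 < r →
      ‖derivWithin σ (Icc 0 1) t‖ ≤ c * ‖derivWithin τ (Icc 0 1) t‖) :
    arcLength σ 0 1 ≤ c * arcLength τ 0 1 := by
  refine le_of_forall_lt_imp_le isPreconnected_Icc (continuousOn_arcLength_left hσ) hr ?_
    (right_mem_Icc.2 zero_le_one) ?_ (left_mem_Icc.2 zero_le_one)
  · exact fun t ht hlt => arcLength_le_mul_arcLength hσ hτ ht.1 ht.2 le_rfl hc fun u hu =>
      h u ⟨ht.1.trans hu.1, hu.2⟩ ((arcLength_mono hσ ht.1 hu.1 hu.2 le_rfl le_rfl).trans_lt hlt)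
  · simpa [arcLength] using mul_nonneg hc (arcLength_nonneg (γ := τ) zero_le_one)

end Curves

/-! ### Derivatives and cones along orbits -/

namespace SingularSystem

variable {ν : ℕ} {S : SingularSystem ν} {m n i : ℕ} {z v w x y : Sp ν} {σ γ : ℝ → Sp ν} {t s : ℝ}

/-- The part of the conditions on the phase space and the map that the geometric estimates use: an
open phase space, and a `C¹` diffeomorphism from a subset of it onto the complement of `S⁻`. -/
structure IsSmoothSystem (S : SingularSystem ν) : Prop where
  isOpen : IsOpen S.M
  source_subset : S.T.source ⊆ S.M
  target_eq : S.T.target = S.M \ S.Sminus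
  contDiffOn : ContDiffOn ℝ 1 S.T S.T.source
  contDiffOn_symm : ContDiffOn ℝ 1 S.T.symm S.T.target

namespace IsSmoothSystem

lemma target_subset (hS : S.IsSmoothSystem) : S.T.target ⊆ S.M :=
  hS.target_eq.trans_subset sdiff_subset

lemma isOpen_dom (hS : S.IsSmoothSystem) : IsOpen (S.dom n) :=
  isOpen_iterateDomain hS.isOpen S.T.open_source hS.contDiffOn.continuousOn

lemma contDiffOn_symm_iterate (hS : S.IsSmoothSystem) :
    ContDiffOn ℝ 1 S.T.symm^[n] (S.bwdDom n) :=
  contDiffOn_iterate hS.contDiffOn_symm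

lemma iterate_mem_M (hS : S.IsSmoothSystem) (hz : z ∈ S.dom n) : S.T^[n] z ∈ S.M :=
  iterate_mem_of_mem_iterateDomain (S.T.mapsTo.mono_right hS.target_subset) hz

lemma iterate_mem_dom (hS : S.IsSmoothSystem) (hz : z ∈ S.dom (m + n)) : S.T^[m] z ∈ S.dom n :=
  iterate_mem_iterateDomain (S.T.mapsTo.mono_right hS.target_subset) hz

lemma iterate_mem_bwdDom (hS : S.IsSmoothSystem) (hz : z ∈ S.dom n) : S.T^[n] z ∈ S.bwdDom n :=
  mapsTo_iterate S.T.mapsTo hS.target_subset S.T.leftInvOn hz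

lemma symm_iterate_mem_dom (hS : S.IsSmoothSystem) (hz : z ∈ S.bwdDom n) :
    S.T.symm^[n] z ∈ S.dom n :=
  mapsTo_iterate S.T.mapsTo_symm hS.source_subset S.T.rightInvOn hz

lemma hasFDerivAt_iterate (hS : S.IsSmoothSystem) (hz : z ∈ S.dom n) :
    HasFDerivAt S.T^[n] (S.D n z) z :=
  ((contDiffOn_iterate hS.contDiffOn).contDiffAt
    (hS.isOpen_dom.mem_nhds hz)).differentiableAt one_ne_zero |>.hasFDerivAt

lemma hasDerivWithinAt_iterate_comp (hS : S.IsSmoothSystem) (hσ : ContDiffOn ℝ 1 σ (Icc 0 1))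
    (ht : t ∈ Icc (0 : ℝ) 1) (hdom : σ t ∈ S.dom n) :
    HasDerivWithinAt (S.T^[n] ∘ σ) (S.D n (σ t) (derivWithin σ (Icc 0 1) t)) (Icc 0 1) t :=
  (hS.hasFDerivAt_iterate hdom).comp_hasDerivWithinAt t (hasDerivWithinAt_of_contDiffOn hσ ht)

lemma derivWithin_iterate_comp (hS : S.IsSmoothSystem) (hσ : ContDiffOn ℝ 1 σ (Icc 0 1))
    (ht : t ∈ Icc (0 : ℝ) 1) (hdom : σ t ∈ S.dom n) :
    derivWithin (S.T^[n] ∘ σ) (Icc 0 1) t = S.D n (σ t) (derivWithin σ (Icc 0 1) t) :=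
  (hS.hasDerivWithinAt_iterate_comp hσ ht hdom).derivWithin (uniqueDiffOn_Icc_zero_one t ht)

lemma D_add (hS : S.IsSmoothSystem) (hz : z ∈ S.dom (m + n)) :
    S.D (m + n) z = (S.D n (S.T^[m] z)).comp (S.D m z) := by
  have hcomp := (hS.hasFDerivAt_iterate (hS.iterate_mem_dom hz)).comp z
    (hS.hasFDerivAt_iterate (antitone_iterateDomain _ _ _ (Nat.le_add_right m n) hz))
  rw [← Function.iterate_add, add_comm n m] at hcomp
  exact hcomp.fderiv

lemma D_succ_apply (hS : S.IsSmoothSystem) (hz : z ∈ S.dom (n + 1)) (v : Sp ν) :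
    S.D (n + 1) z v = S.D 1 (S.T^[n] z) (S.D n z v) := by
  rw [hS.D_add hz, ContinuousLinearMap.comp_apply]

lemma D_injective (hS : S.IsSmoothSystem) (hz : z ∈ S.dom n) : Function.Injective (S.D n z) := by
  have hinv : HasFDerivAt S.T.symm^[n] (fderiv ℝ S.T.symm^[n] (S.T^[n] z)) (S.T^[n] z) :=
    (hS.contDiffOn_symm_iterate.contDiffAt
      ((isOpen_iterateDomain hS.isOpen S.T.open_target
        hS.contDiffOn_symm.continuousOn).mem_nhds (hS.iterate_mem_bwdDom hz))).differentiableAt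
      one_ne_zero |>.hasFDerivAt
  have hid : S.T.symm^[n] ∘ S.T^[n] =ᶠ[𝓝 z] id :=
    EqOn.eventuallyEq_of_mem (leftInvOn_iterate S.T.leftInvOn) (hS.isOpen_dom.mem_nhds hz)
  have hcomp := (hinv.comp z (hS.hasFDerivAt_iterate hz)).unique
    ((hasFDerivAt_id z).congr_of_eventuallyEq hid)
  exact Function.LeftInverse.injective fun v => DFunLike.congr_fun hcomp v

lemma nestedCone_add (hS : S.IsSmoothSystem) (hz : z ∈ S.bwdDom (n + i)) :
    S.nestedCone (n + i) z = S.D i (S.T.symm^[i] z) '' S.nestedCone n (S.T.symm^[i] z) := by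
  have hw : S.T.symm^[n] (S.T.symm^[i] z) ∈ S.dom (n + i) := by
    rw [← Function.iterate_add_apply]
    exact hS.symm_iterate_mem_dom hz
  have hzi : S.T.symm^[i] z ∈ S.bwdDom n :=
    iterate_mem_iterateDomain (S.T.mapsTo_symm.mono_right hS.source_subset) (add_comm n i ▸ hz)
  rw [nestedCone, nestedCone, image_image, Function.iterate_add_apply, hS.D_add hw,
    leftInvOn_iterate S.T.rightInvOn hzi]
  rfl

end IsSmoothSystem

/-- A smooth system with a continuous invariant field of closed cones; unlike in `ConeCondition`
the invariance need not eventually become strict. -/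
structure HasInvariantCones (S : SingularSystem ν) : Prop extends S.IsSmoothSystem where
  isClosed_cone : ∀ z ∈ S.M, IsClosed (S.cone z)
  zero_mem_cone : ∀ z ∈ S.M, (0 : Sp ν) ∈ S.cone z
  smul_mem_cone : ∀ z ∈ S.M, ∀ v ∈ S.cone z, ∀ t : ℝ, t • v ∈ S.cone z
  continuous_cone : ∀ z ∈ S.T.source, ∀ ε > 0, ∀ᶠ w in 𝓝 z,
    (∀ v ∈ S.cone w, ‖v‖ = 1 → ∃ u ∈ S.cone z, ‖u - v‖ < ε) ∧
    (∀ v ∈ S.cone z, ‖v‖ = 1 → ∃ u ∈ S.cone w, ‖u - v‖ < ε)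
  image_cone_subset : ∀ z ∈ S.T.source, S.D 1 z '' S.cone z ⊆ S.cone (S.T z)

lemma PhaseSpaceCondition.hasInvariantCones (hphase : S.PhaseSpaceCondition)
    (hmap : S.MapCondition) (hcone : S.ConeCondition) : S.HasInvariantCones where
  isOpen := hphase.isOpen
  source_subset := hmap.source_eq.trans_subset sdiff_subset
  target_eq := hmap.target_eq
  contDiffOn := hmap.contDiffOn
  contDiffOn_symm := hmap.contDiffOn_symm
  isClosed_cone := hcone.isClosed
  zero_mem_cone := hcone.zero_mem
  smul_mem_cone := hcone.smul_mem
  continuous_cone := hcone.continuous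
  image_cone_subset := hcone.invariant

/-- The bundle of first nested cones over `M \ S⁻`; its closure contains `coneOne` over all
of `M`. -/
def coneOneGraph (S : SingularSystem ν) : Set (Sp ν × Sp ν) :=
  {p | p.1 ∈ S.T.target ∧ p.2 ∈ S.nestedCone 1 p.1}

lemma IsSmoothSystem.mem_closure_coneOneGraph (hS : S.IsSmoothSystem) (hz : z ∈ S.M)
    (hv : v ∈ S.coneOne z) : (z, v) ∈ closure S.coneOneGraph := by
  rcases hv with ⟨hz', hv⟩ | ⟨-, hv⟩
  · exact subset_closure ⟨hS.target_eq ▸ ⟨hz, hz'⟩, hv⟩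
  · exact hv

namespace HasInvariantCones

lemma D_mem_cone (hS : S.HasInvariantCones) (hz : z ∈ S.dom n) (hv : v ∈ S.cone z) :
    S.D n z v ∈ S.cone (S.T^[n] z) := by
  induction n with
  | zero => simpa [D] using hv
  | succ n ih =>
    obtain ⟨hz', hsource⟩ := mem_iterateDomain_succ.1 hz
    rw [hS.D_succ_apply hz, Function.iterate_succ_apply']
    exact hS.image_cone_subset _ hsource ⟨_, ih hz', rfl⟩

lemma nestedCone_one_subset (hS : S.HasInvariantCones) (hz : z ∈ S.T.target) :
    S.nestedCone 1 z ⊆ S.cone z := by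
  simpa only [nestedCone, Function.iterate_one, S.T.right_inv hz] using
    hS.image_cone_subset _ (S.T.map_target hz)

lemma mem_cone_of_mem_closure_of_norm_eq_one (hS : S.HasInvariantCones) (hz : z ∈ S.T.source)
    (hv : (z, v) ∈ closure {p : Sp ν × Sp ν | p.1 ∈ S.M ∧ p.2 ∈ S.cone p.1 ∧ ‖p.2‖ = 1}) :
    v ∈ S.cone z := by
  rw [← (hS.isClosed_cone z (hS.source_subset hz)).closure_eq, Metric.mem_closure_iff]
  intro ε hε
  have hcont := (hS.continuous_cone z hz (ε / 2) (half_pos hε)).prod_inl_nhds v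
  have hnear := Eventually.prod_inr_nhds (Metric.eventually_nhds_iff.2
    ⟨ε / 2, half_pos hε, fun _ hu => hu⟩ : ∀ᶠ u in 𝓝 v, dist u v < ε / 2) z
  obtain ⟨⟨w, u⟩, ⟨-, hu, hu1⟩, hw, hvu⟩ :=
    ((mem_closure_iff_frequently.1 hv).and_eventually (hcont.and hnear)).exists
  obtain ⟨u', hu', hdist⟩ := hw.1 u hu hu1
  refine ⟨u', hu', ?_⟩
  rw [← dist_eq_norm, dist_comm] at hdist
  calc dist v u' ≤ dist u v + dist u u' := dist_triangle_left _ _ _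
    _ < ε / 2 + ε / 2 := add_lt_add hvu hdist
    _ = ε := add_halves ε

lemma mem_cone_of_mem_closure (hS : S.HasInvariantCones) (hz : z ∈ S.T.source)
    (hv : (z, v) ∈ closure S.coneOneGraph) : v ∈ S.cone z := by
  have hzM := hS.source_subset hz
  by_cases hv0 : v = 0
  · exact hv0 ▸ hS.zero_mem_cone z hzM
  have hcont : ContinuousAt (fun p : Sp ν × Sp ν => (p.1, ‖p.2‖⁻¹ • p.2)) (z, v) := by
    have := norm_ne_zero_iff.2 hv0
    fun_prop (disch := assumption)
  have hne : ∀ᶠ p : Sp ν × Sp ν in 𝓝 (z, v), p.2 ≠ 0 := continuousAt_snd.eventually_ne hv0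
  have hunit := hS.mem_cone_of_mem_closure_of_norm_eq_one hz (mem_closure_iff_frequently.2
    (hcont.frequently (((mem_closure_iff_frequently.1 hv).and_eventually hne).mono
      fun p ⟨⟨hp, hpv⟩, hp0⟩ => ⟨hS.target_subset hp, hS.smul_mem_cone _ (hS.target_subset hp) _
        (hS.nestedCone_one_subset hp hpv) _, norm_smul_inv_norm (𝕜 := ℝ) hp0⟩)))
  simpa [smul_smul, hv0] using hS.smul_mem_cone z hzM _ hunit ‖v‖

lemma coneOne_subset_cone (hS : S.HasInvariantCones) (hz : z ∈ S.T.source) :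
    S.coneOne z ⊆ S.cone z := fun _ hv =>
  hS.mem_cone_of_mem_closure hz (hS.mem_closure_coneOneGraph (hS.source_subset hz) hv)

lemma smul_mem_nestedCone_one (hS : S.HasInvariantCones) (hz : z ∈ S.T.target)
    (hv : v ∈ S.nestedCone 1 z) (c : ℝ) : c • v ∈ S.nestedCone 1 z := by
  obtain ⟨u, hu, rfl⟩ := hv
  exact ⟨c • u, hS.smul_mem_cone _ (hS.source_subset (S.T.map_target hz)) u hu c, map_smul _ _ _⟩

lemma smul_mem_coneOne (hS : S.HasInvariantCones) (hz : z ∈ S.M) (hv : v ∈ S.coneOne z) (c : ℝ) :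
    c • v ∈ S.coneOne z := by
  rcases hv with ⟨hz', hv⟩ | ⟨hz', hv⟩
  · exact Or.inl ⟨hz', hS.smul_mem_nestedCone_one (hS.target_eq ▸ ⟨hz, hz'⟩) hv c⟩
  · have hcont : Continuous fun p : Sp ν × Sp ν => (p.1, c • p.2) := by fun_prop
    have hmaps : MapsTo (fun p : Sp ν × Sp ν => (p.1, c • p.2)) S.coneOneGraph S.coneOneGraph :=
      fun p hp => ⟨hp.1, hS.smul_mem_nestedCone_one hp.1 hp.2 c⟩
    exact Or.inr ⟨hz', hmaps.closure hcont hv⟩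

end HasInvariantCones

/-! ### Unstable curves -/

lemma IsUnstableCurve.comp_lineMap (hS : S.HasInvariantCones) (hσ : S.IsUnstableCurve σ x y)
    (hs : s ∈ Icc (0 : ℝ) 1) :
    S.IsUnstableCurve (σ ∘ AffineMap.lineMap s 1) (σ s) y where
  contDiffOn := contDiffOn_comp_lineMap hσ.contDiffOn hs
  start := by simp
  finish := by simp [hσ.finish]
  mem u hu := hσ.mem _ (lineMap_mem_Icc_zero_one hs hu)
  tangent u hu := by
    rw [derivWithin_comp_lineMap hσ.contDiffOn hs hu]
    have hsu := lineMap_mem_Icc_zero_one hs hu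
    exact hS.smul_mem_coneOne (hσ.mem _ hsu) (hσ.tangent _ hsu) _

lemma IsUnstableCurve.mem_tube (hS : S.HasInvariantCones) (hσ : S.IsUnstableCurve σ x y)
    {A : Set (Sp ν)} (hy : y ∈ A) (hs : s ∈ Icc (0 : ℝ) 1) {ε : ℝ} (hε : arcLength σ s 1 ≤ ε) :
    σ s ∈ S.tube A ε := by
  refine ⟨hσ.mem s hs, (iInf₂_le y hy).trans
    ((iInf₂_le (σ ∘ AffineMap.lineMap s 1) (hσ.comp_lineMap hS hs)).trans ?_)⟩
  rw [curveLength_eq_ofReal_arcLength (contDiffOn_comp_lineMap hσ.contDiffOn hs),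
    arcLength_comp_lineMap hσ.contDiffOn hs]
  exact ENNReal.ofReal_le_ofReal hε

/-- An unstable curve `σ` from `w` to the singularity set, on which `Tⁱ` is defined and has an
image of length less than `δ`: the preimage under `Tⁱ` of a short curve along which a local
unstable manifold is cut by `Tⁱ S⁻`. -/
structure IsCutPreimage (S : SingularSystem ν) (i : ℕ) (δ : ℝ) (σ : ℝ → Sp ν) (w y : Sp ν) : Prop
    extends S.IsUnstableCurve σ w y where
  mem_Sminus : y ∈ S.Sminus
  mem_dom : ∀ t ∈ Icc (0 : ℝ) 1, σ t ∈ S.dom i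
  arcLength_lt : arcLength (S.T^[i] ∘ σ) 0 1 < δ

/-- The points of `U` at which some local unstable manifold has radius less than `δ` because it is
cut by `Tⁱ S⁻` for some `i > m`. -/
def cutSet (S : SingularSystem ν) (U : Set (Sp ν)) (m : ℕ) (δ : ℝ) : Set (Sp ν) :=
  {z ∈ U | ∃ W, S.IsLocalUnstableManifold z W ∧
    radiusCutBy z W (⋃ i > m, S.imageSminus i) < ENNReal.ofReal δ}

lemma IsLocalUnstableManifold.mem_bwdDom {W : Set (Sp ν)} (hW : S.IsLocalUnstableManifold z W)
    (hw : w ∈ W) (n : ℕ) : w ∈ S.bwdDom n := by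
  obtain ⟨-, -, -, -, -, -, -, hbwd, -⟩ := hW
  exact (hbwd w hw).1 n

lemma IsLocalUnstableManifold.derivWithin_mem_nestedCone {W : Set (Sp ν)}
    (hW : S.IsLocalUnstableManifold z W) (hγ : ContDiffOn ℝ 1 γ (Icc 0 1))
    (hγW : ∀ t ∈ Ico (0 : ℝ) 1, γ t ∈ W) (ht : t ∈ Ico (0 : ℝ) 1) (n : ℕ) :
    derivWithin γ (Icc 0 1) t ∈ S.nestedCone n (γ t) := by
  obtain ⟨-, d, φ, hφ, hφemb, hinj, rfl, -, hcone⟩ := hW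
  obtain ⟨x, hx⟩ := hγW t ht
  rw [← hx]
  exact (hcone x).1 n (mem_range_of_hasDerivWithinAt_of_isEmbedding hφemb
    (hφ.differentiable one_ne_zero x).hasFDerivAt
    (ContinuousLinearMap.HasLeftInverse.of_injective_of_finiteDimensional (hinj x))
    ((hasDerivWithinAt_of_contDiffOn hγ (Ico_subset_Icc_self ht)).mono Ico_subset_Icc_self)
    (uniqueDiffOn_Ico 0 1 t ht) ht hx hγW)

lemma IsSmoothSystem.derivWithin_symm_iterate_comp_mem_nestedCone (hS : S.IsSmoothSystem)
    (hγ : ContDiffOn ℝ 1 γ (Icc 0 1)) (hdom : ∀ t ∈ Icc (0 : ℝ) 1, γ t ∈ S.bwdDom i)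
    (ht : t ∈ Icc (0 : ℝ) 1) (htdom : γ t ∈ S.bwdDom (n + i))
    (htan : derivWithin γ (Icc 0 1) t ∈ S.nestedCone (n + i) (γ t)) :
    derivWithin (S.T.symm^[i] ∘ γ) (Icc 0 1) t ∈ S.nestedCone n (S.T.symm^[i] (γ t)) := by
  have hσ : ContDiffOn ℝ 1 (S.T.symm^[i] ∘ γ) (Icc 0 1) := hS.contDiffOn_symm_iterate.comp hγ hdom
  have hσdom : (S.T.symm^[i] ∘ γ) t ∈ S.dom i := hS.symm_iterate_mem_dom (hdom t ht)
  have hcomp : EqOn (S.T^[i] ∘ S.T.symm^[i] ∘ γ) γ (Icc 0 1) := fun u hu =>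
    leftInvOn_iterate S.T.rightInvOn (hdom u hu)
  rw [hS.nestedCone_add htdom, ← derivWithin_congr hcomp (hcomp ht),
    hS.derivWithin_iterate_comp hσ ht hσdom] at htan
  exact (hS.D_injective hσdom).mem_set_image.1 htan

lemma IsSmoothSystem.isUnstableCurve_of_forall_mem_nestedCone (hS : S.IsSmoothSystem)
    (hσ : ContDiffOn ℝ 1 σ (Icc 0 1)) (htarget : ∀ t ∈ Ico (0 : ℝ) 1, σ t ∈ S.T.target)
    (h1 : σ 1 ∈ S.M ∩ S.Sminus)
    (htan : ∀ t ∈ Ico (0 : ℝ) 1, derivWithin σ (Icc 0 1) t ∈ S.nestedCone 1 (σ t)) :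
    S.IsUnstableCurve σ (σ 0) (σ 1) where
  contDiffOn := hσ
  start := rfl
  finish := rfl
  mem t ht := by
    rcases ht.2.eq_or_lt with rfl | ht1
    · exact h1.1
    · exact hS.target_subset (htarget t ⟨ht.1, ht1⟩)
  tangent t ht := by
    rcases ht.2.eq_or_lt with rfl | ht1
    · have hcont : ContinuousOn (fun t => (σ t, derivWithin σ (Icc 0 1) t)) (Icc 0 1) :=
        hσ.continuousOn.prodMk (hσ.continuousOn_derivWithin uniqueDiffOn_Icc_zero_one le_rfl)
      refine Or.inr ⟨h1.2, ((hcont 1 ht).mono Ico_subset_Icc_self).mem_closure ?_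
        fun t ht => ⟨htarget t ht, htan t ht⟩⟩
      rwa [closure_Ico zero_ne_one]
    · have hσt := htarget t ⟨ht.1, ht1⟩
      rw [hS.target_eq] at hσt
      exact Or.inl ⟨hσt.2, htan t ⟨ht.1, ht1⟩⟩

lemma IsLocalUnstableManifold.isCutPreimage (hS : S.IsSmoothSystem) {W : Set (Sp ν)}
    (hW : S.IsLocalUnstableManifold z W) (hγ : ContDiffOn ℝ 1 γ (Icc 0 1))
    (hγW : ∀ t ∈ Ico (0 : ℝ) 1, γ t ∈ W) (h1 : γ 1 ∈ S.imageSminus i) {δ : ℝ}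
    (hδ : arcLength γ 0 1 < δ) :
    S.IsCutPreimage i δ (S.T.symm^[i] ∘ γ) (S.T.symm^[i] (γ 0)) (S.T.symm^[i] (γ 1)) := by
  obtain ⟨y, ⟨hyS, hydom⟩, hy⟩ := h1
  have hσ1 : S.T.symm^[i] (γ 1) = y := hy ▸ leftInvOn_iterate S.T.leftInvOn hydom
  have hdom : ∀ t ∈ Icc (0 : ℝ) 1, γ t ∈ S.bwdDom i := fun t ht => by
    rcases ht.2.eq_or_lt with rfl | ht1
    · exact hy ▸ hS.iterate_mem_bwdDom hydom
    · exact hW.mem_bwdDom (hγW t ⟨ht.1, ht1⟩) i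
  have hcomp : EqOn (S.T^[i] ∘ S.T.symm^[i] ∘ γ) γ (Icc 0 1) := fun u hu =>
    leftInvOn_iterate S.T.rightInvOn (hdom u hu)
  have hbwd : ∀ t ∈ Ico (0 : ℝ) 1, γ t ∈ S.bwdDom (1 + i) := fun t ht =>
    hW.mem_bwdDom (hγW t ht) _
  have hcurve : S.IsUnstableCurve (S.T.symm^[i] ∘ γ) (S.T.symm^[i] (γ 0)) (S.T.symm^[i] (γ 1)) :=
    hS.isUnstableCurve_of_forall_mem_nestedCone (hS.contDiffOn_symm_iterate.comp hγ hdom)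
      (fun t ht => (hbwd t ht).2 i (by omega)) (by simp [hσ1, hydom.1, hyS]) fun t ht =>
        hS.derivWithin_symm_iterate_comp_mem_nestedCone hγ hdom (Ico_subset_Icc_self ht)
          (hbwd t ht) (hW.derivWithin_mem_nestedCone hγ hγW ht _)
  refine ⟨hcurve, hσ1 ▸ hyS, fun t ht => hS.symm_iterate_mem_dom (hdom t ht), ?_⟩
  rwa [arcLength_congr hcomp le_rfl zero_le_one le_rfl]

lemma exists_isCutPreimage (hS : S.IsSmoothSystem) {U : Set (Sp ν)} {δ : ℝ}
    (hz : z ∈ S.cutSet U m δ) :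
    ∃ i > m, ∃ σ w y, S.IsCutPreimage i δ σ w y ∧ S.T^[i] w = z := by
  obtain ⟨-, W, hW, hcut⟩ := hz
  simp only [radiusCutBy, iInf_lt_iff] at hcut
  obtain ⟨γ, ⟨hγ, rfl, hγW, -, hcut⟩, hlen⟩ := hcut
  obtain ⟨i, hi, hγi⟩ := mem_iUnion₂.1 hcut
  rw [curveLength_eq_ofReal_arcLength hγ,
    ENNReal.ofReal_lt_ofReal_iff_of_nonneg (arcLength_nonneg zero_le_one)] at hlen
  exact ⟨i, hi, _, _, _, hW.isCutPreimage hS hγ hγW hγi hlen,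
    leftInvOn_iterate S.T.rightInvOn (hW.mem_bwdDom hW.1 i)⟩

end SingularSystem

/-! ### Expansion of the norm along orbits -/

section Visits

open Classical in
/-- The number of visits of the `f`-orbit of `x` to `U` at times in `[p, n)`. -/
noncomputable def visits {α : Type*} (f : α → α) (U : Set α) (p n : ℕ) (x : α) : ℕ :=
  Nat.count (fun j => p ≤ j ∧ f^[j] x ∈ U) n

lemma exists_visits_eq_zero {α : Type*} {f : α → α} {U : Set α} {p i : ℕ} {x : α} (hpi : p ≤ i)
    (hx : f^[i] x ∈ U) : ∃ n, p ≤ n ∧ n ≤ i ∧ f^[n] x ∈ U ∧ visits f U p n x = 0 := by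
  classical
  have hex : ∃ n, p ≤ n ∧ f^[n] x ∈ U := ⟨i, hpi, hx⟩
  refine ⟨Nat.find hex, (Nat.find_spec hex).1, Nat.find_min' hex ⟨hpi, hx⟩,
    (Nat.find_spec hex).2, ?_⟩
  exact Nat.count_iff_forall_not.2 fun j hj => Nat.find_min hex hj

lemma pow_count_mul_le {R : Type*} [CommSemiring R] [PartialOrder R] [IsOrderedRing R]
    {x : ℕ → R} {q : ℕ → Prop} [DecidablePred q] {c : R} (hc : 0 ≤ c) {n i : ℕ} (hni : n ≤ i)
    (hx : ∀ j < i, n ≤ j → x j ≤ x (j + 1)) (hq : ∀ j < i, n ≤ j → q j → c * x j ≤ x (j + 1)) :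
    c ^ Nat.count q i * x n ≤ c ^ Nat.count q n * x i := by
  induction i, hni using Nat.le_induction with
  | base => exact le_rfl
  | succ i hni ih =>
    have ih := ih (fun j hj => hx j (by omega)) fun j hj => hq j (by omega)
    by_cases hqi : q i
    · rw [Nat.count_succ, if_pos hqi, pow_succ']
      calc c * c ^ Nat.count q i * x n = c * (c ^ Nat.count q i * x n) := mul_assoc _ _ _
        _ ≤ c * (c ^ Nat.count q n * x i) := by gcongr
        _ = c ^ Nat.count q n * (c * x i) := mul_left_comm _ _ _
        _ ≤ _ := by gcongr; exact hq i i.lt_succ_self hni hqi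
    · rw [Nat.count_succ, if_neg hqi, add_zero]
      exact ih.trans (by gcongr; exact hx i i.lt_succ_self hni)

end Visits

namespace SingularSystem

variable {ν : ℕ} {S : SingularSystem ν} {N : Sp ν → Sp ν → ℝ} {m n i p : ℕ} {z z₀ v w : Sp ν}
  {a b r R κ : ℝ}

namespace IsIncreasingNorm

lemma nonneg (hnorm : S.IsIncreasingNorm N) (hz : z ∈ S.M) (hv : v ∈ S.cone z) : 0 ≤ N z v := by
  obtain ⟨a, ha, b, -, h⟩ := hnorm.locally_equivalent z hz
  exact (by positivity : 0 ≤ a * ‖v‖).trans (h.self_of_nhds v hv).1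

lemma nonneg_iterate (hnorm : S.IsIncreasingNorm N) (hS : S.HasInvariantCones) (hz : z ∈ S.dom n)
    (hv : v ∈ S.cone z) : 0 ≤ N (S.T^[n] z) (S.D n z v) :=
  hnorm.nonneg (hS.iterate_mem_M hz) (hS.D_mem_cone hz hv)

lemma le_map (hnorm : S.IsIncreasingNorm N) (hS : S.HasInvariantCones) (hz : z ∈ S.T.source)
    (hv : v ∈ S.cone z) : N z v ≤ N (S.T z) (S.D 1 z v) := by
  obtain ⟨κ, hκ, -⟩ := hnorm.increasing
  exact (le_mul_of_one_le_left (hnorm.nonneg (hS.source_subset hz) hv) (hκ z hz).1.le).trans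
    ((hκ z hz).2 v hv)

lemma exists_factor (hnorm : S.IsIncreasingNorm N) (hS : S.HasInvariantCones) (hz₀ : z₀ ∈ S.M) :
    ∃ κ > (1 : ℝ), ∀ᶠ z in 𝓝 z₀, z ∈ S.T.source → ∀ v ∈ S.cone z,
      κ * N z v ≤ N (S.T z) (S.D 1 z v) := by
  obtain ⟨κ, hκ, hne⟩ := hnorm.increasing
  suffices h : ∃ c > (1 : ℝ), ∀ᶠ z in 𝓝 z₀, z ∈ S.T.source → c ≤ κ z by
    obtain ⟨c, hc, h⟩ := h
    refine ⟨c, hc, h.mono fun z hcz hz v hv => ?_⟩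
    exact (mul_le_mul_of_nonneg_right (hcz hz) (hnorm.nonneg (hS.source_subset hz) hv)).trans
      ((hκ z hz).2 v hv)
  by_contra! hcon
  have hpos : ∀ n : ℕ, (0 : ℝ) < 1 / (n + 1 : ℝ) := fun n => Nat.one_div_pos_of_nat
  choose x hx hdist using fun n : ℕ =>
    ((hcon (1 + 1 / (n + 1 : ℝ)) (lt_add_of_pos_right 1 (hpos n))).and_eventually
      (Metric.ball_mem_nhds z₀ (hpos n))).exists
  have hlim : Tendsto (fun n : ℕ => 1 / (n + 1 : ℝ)) atTop (𝓝 0) :=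
    tendsto_one_div_add_atTop_nhds_zero_nat
  refine eq_empty_iff_forall_notMem.1 hne z₀
    ⟨hz₀, x, fun n => (hx n).1, tendsto_iff_dist_tendsto_zero.2 ?_, ?_⟩
  · exact squeeze_zero (fun _ => dist_nonneg) (fun n => (hdist n).le) hlim
  · exact tendsto_of_tendsto_of_tendsto_of_le_of_le tendsto_const_nhds
      (by simpa using hlim.const_add 1) (fun n => (hκ _ (hx n).1).1.le) fun n => (hx n).2.le

lemma le_iterate_succ (hnorm : S.IsIncreasingNorm N) (hS : S.HasInvariantCones)
    (hw : w ∈ S.dom (n + 1)) (hv : v ∈ S.cone w) :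
    N (S.T^[n] w) (S.D n w v) ≤ N (S.T^[n + 1] w) (S.D (n + 1) w v) := by
  obtain ⟨hwn, hsource⟩ := mem_iterateDomain_succ.1 hw
  rw [hS.D_succ_apply hw, Function.iterate_succ_apply']
  exact hnorm.le_map hS hsource (hS.D_mem_cone hwn hv)

lemma le_iterate (hnorm : S.IsIncreasingNorm N) (hS : S.HasInvariantCones) (hmn : m ≤ n)
    (hw : w ∈ S.dom n) (hv : v ∈ S.cone w) :
    N (S.T^[m] w) (S.D m w v) ≤ N (S.T^[n] w) (S.D n w v) := by
  induction n, hmn using Nat.le_induction with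
  | base => exact le_rfl
  | succ n _ ih =>
    exact (ih (antitone_iterateDomain _ _ _ n.le_succ hw)).trans (hnorm.le_iterate_succ hS hw hv)

lemma pow_visits_mul_le (hnorm : S.IsIncreasingNorm N) (hS : S.HasInvariantCones) (hκ : 1 ≤ κ)
    {B : Set (Sp ν)}
    (hB : ∀ z ∈ B, z ∈ S.T.source → ∀ v ∈ S.cone z, κ * N z v ≤ N (S.T z) (S.D 1 z v))
    (hni : n ≤ i) {w₀ : Sp ν} {U : Set (Sp ν)} (hvis : visits S.T U p n w₀ = 0)
    (hUB : ∀ j < i, S.T^[j] w₀ ∈ U → S.T^[j] w ∈ B) (hw : w ∈ S.dom i) (hv : v ∈ S.cone w) :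
    κ ^ visits S.T U p i w₀ * N (S.T^[n] w) (S.D n w v) ≤ N (S.T^[i] w) (S.D i w v) := by
  classical
  have hdom : ∀ j < i, w ∈ S.dom (j + 1) := fun j hj => antitone_iterateDomain _ _ _ hj hw
  have hpow : κ ^ visits S.T U p i w₀ * N (S.T^[n] w) (S.D n w v) ≤
      κ ^ visits S.T U p n w₀ * N (S.T^[i] w) (S.D i w v) := by
    refine pow_count_mul_le (x := fun j => N (S.T^[j] w) (S.D j w v))
      (q := fun j => p ≤ j ∧ S.T^[j] w₀ ∈ U) (zero_le_one.trans hκ) hni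
      (fun j hj _ => hnorm.le_iterate_succ hS (hdom j hj) hv) fun j hj _ hq => ?_
    obtain ⟨hwj, hsource⟩ := mem_iterateDomain_succ.1 (hdom j hj)
    rw [hS.D_succ_apply (hdom j hj), Function.iterate_succ_apply']
    exact hB _ (hUB j hj hq.2) hsource _ (hS.D_mem_cone hwj hv)
  rwa [hvis, pow_zero, one_mul] at hpow

end IsIncreasingNorm

/-- A ball `B(z₀, 2r)` in which the norm `N` is comparable with the Euclidean norm, with constants
`a` and `b`, and is increased by the factor `κ` at each visit, and in which the vectors of the first
nested cones near `S⁻` arrive with a norm at least `a` times the original length. -/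
structure IsExpansionBall (S : SingularSystem ν) (N : Sp ν → Sp ν → ℝ) (z₀ : Sp ν)
    (r a b κ : ℝ) : Prop where
  r_pos : 0 < r
  a_pos : 0 < a
  a_le_b : a ≤ b
  one_lt : 1 < κ
  le_norm : ∀ z ∈ Metric.ball z₀ (2 * r), ∀ v ∈ S.cone z, a * ‖v‖ ≤ N z v
  norm_le : ∀ z ∈ Metric.ball z₀ (2 * r), ∀ v ∈ S.cone z, N z v ≤ b * ‖v‖
  factor : ∀ z ∈ Metric.ball z₀ (2 * r), z ∈ S.T.source → ∀ v ∈ S.cone z,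
    κ * N z v ≤ N (S.T z) (S.D 1 z v)
  le_norm_iterate : ∀ w ∈ S.tube S.Sminus r, ∀ n > 0, w ∈ S.dom n →
    S.T^[n] w ∈ Metric.ball z₀ (2 * r) → ∀ v ∈ S.coneOne w, a * ‖v‖ ≤ N (S.T^[n] w) (S.D n w v)

lemma tube_mono {A B : Set (Sp ν)} {ε ε' : ℝ} (hAB : A ⊆ B) (hε : ε ≤ ε') :
    S.tube A ε ⊆ S.tube B ε' := fun _ hz =>
  ⟨hz.1, (biInf_mono hAB).trans (hz.2.trans (ENNReal.ofReal_le_ofReal hε))⟩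

lemma exists_isExpansionBall (hS : S.HasInvariantCones) (hnc : S.NonContractionCondition)
    (hnorm : S.IsIncreasingNorm N) (hz₀ : z₀ ∈ S.M) :
    ∃ r a b κ, S.IsExpansionBall N z₀ r a b κ := by
  obtain ⟨U₀, hU₀, ε₀, hε₀, K, hK, hnc⟩ := hnc z₀ hz₀
  obtain ⟨a, ha, b, -, hab⟩ := hnorm.locally_equivalent z₀ hz₀
  obtain ⟨κ, hκ, hfactor⟩ := hnorm.exists_factor hS hz₀
  obtain ⟨ρ, hρ, hball⟩ := Metric.eventually_nhds_iff_ball.1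
    ((eventually_mem_set.2 hU₀).and (hab.and hfactor))
  have hsub : Metric.ball z₀ (2 * min (ρ / 2) ε₀) ⊆ Metric.ball z₀ ρ :=
    Metric.ball_subset_ball (by linarith [min_le_left (ρ / 2) ε₀])
  have hle : ∀ z ∈ Metric.ball z₀ (2 * min (ρ / 2) ε₀), ∀ v ∈ S.cone z, a * ‖v‖ ≤ N z v :=
    fun z hz v hv => ((hball z (hsub hz)).2.1 v hv).1
  refine ⟨min (ρ / 2) ε₀, a * min K 1, max a b, κ, lt_min (half_pos hρ) hε₀,
    mul_pos ha (lt_min hK one_pos), ?_, hκ, fun z hz v hv => ?_, fun z hz v hv => ?_,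
    fun z hz => (hball z (hsub hz)).2.2, fun w hw n hn hdom hwn v hv => ?_⟩
  · exact (mul_le_of_le_one_right ha.le (min_le_right K 1)).trans (le_max_left a b)
  · refine le_trans ?_ (hle z hz v hv)
    gcongr
    exact mul_le_of_le_one_right ha.le (min_le_right K 1)
  · exact ((hball z (hsub hz)).2.1 v hv).2.trans (by gcongr; exact le_max_right a b)
  · calc a * min K 1 * ‖v‖ ≤ a * (K * ‖v‖) := by
          rw [mul_assoc]; gcongr; exact min_le_left K 1
      _ ≤ a * ‖S.D n w v‖ := by
          gcongr
          exact hnc w (tube_mono subset_rfl (min_le_right _ _) hw) n hn hdom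
            (hball _ (hsub hwn)).1 v hv
      _ ≤ N (S.T^[n] w) (S.D n w v) :=
          hle _ hwn _ (hS.D_mem_cone hdom (hS.coneOne_subset_cone (hdom.2 0 hn) hv))

/-! ### Expansion near the singularity set -/

/-- The interior of the set of points where all iterates of order at least `m` expand the vectors
of the first nested cone by the factor `R`. -/
def expandingSet (S : SingularSystem ν) (N : Sp ν → Sp ν → ℝ) (R : ℝ) (m : ℕ) : Set (Sp ν) :=
  interior {w | ∀ n ≥ m, w ∈ S.dom n → ∀ v ∈ S.coneOne w,
    R * ‖v‖ ≤ N (S.T^[n] w) (S.D n w v)}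

lemma monotone_expandingSet (S : SingularSystem ν) (N : Sp ν → Sp ν → ℝ) (R : ℝ) :
    Monotone (S.expandingSet N R) := fun _ _ hmn =>
  interior_mono fun _ hw n hn => hw n (hmn.trans hn)

lemma IsIncreasingNorm.continuousOn_iterate (hnorm : S.IsIncreasingNorm N)
    (hS : S.HasInvariantCones) :
    ContinuousOn (fun p : Sp ν × Sp ν => N (S.T^[n] p.1) (S.D n p.1 p.2))
      {p | p.1 ∈ S.dom n ∧ p.2 ∈ S.cone p.1} := by
  have hfst : MapsTo Prod.fst {p : Sp ν × Sp ν | p.1 ∈ S.dom n ∧ p.2 ∈ S.cone p.1} (S.dom n) :=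
    fun _ hp => hp.1
  have hT : ContinuousOn S.T^[n] (S.dom n) :=
    _root_.continuousOn_iterate hS.contDiffOn.continuousOn
  have hD : ContinuousOn (S.D n) (S.dom n) :=
    (contDiffOn_iterate hS.contDiffOn).continuousOn_fderiv_of_isOpen hS.isOpen_dom le_rfl
  exact hnorm.continuousOn.comp ((hT.comp continuousOn_fst hfst).prodMk
    ((hD.comp continuousOn_fst hfst).clm_apply continuousOn_snd))
    fun p hp => ⟨hS.iterate_mem_M hp.1, hS.D_mem_cone hp.1 hp.2⟩

lemma IsIncreasingNorm.mul_norm_le_iterate_of_norm_eq_one (hnorm : S.IsIncreasingNorm N)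
    (hS : S.HasInvariantCones) (hn : 0 < n) (hw : w ∈ S.dom n)
    (h : ∀ u ∈ S.coneOne w, ‖u‖ = 1 → R ≤ N (S.T^[n] w) (S.D n w u)) (hv : v ∈ S.coneOne w) :
    R * ‖v‖ ≤ N (S.T^[n] w) (S.D n w v) := by
  have hcone := hS.coneOne_subset_cone (hw.2 0 hn)
  by_cases hv0 : v = 0
  · simpa [hv0] using hnorm.nonneg_iterate hS hw (hcone hv)
  have hunit := h _ (hS.smul_mem_coneOne hw.1 hv ‖v‖⁻¹) (norm_smul_inv_norm (𝕜 := ℝ) hv0)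
  rwa [map_smul, hnorm.smul _ (hS.iterate_mem_M hw) _ (hS.D_mem_cone hw (hcone hv)),
    abs_of_nonneg (by positivity), le_inv_mul_iff₀ (norm_pos_iff.2 hv0), mul_comm] at hunit

lemma IsIncreasingNorm.eventually_mul_norm_le_iterate (hnorm : S.IsIncreasingNorm N)
    (hS : S.HasInvariantCones) (hz : z ∈ S.Sminus) (hn : 0 < n) (hzn : z ∈ S.dom n)
    (h : ∀ v ∈ S.coneOne z, ‖v‖ = 1 → R < N (S.T^[n] z) (S.D n z v)) :
    ∀ᶠ w in 𝓝 z, w ∈ S.dom n → ∀ v ∈ S.coneOne w, R * ‖v‖ ≤ N (S.T^[n] w) (S.D n w v) := by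
  have hsphere : ∀ᶠ w in 𝓝 z, ∀ v ∈ Metric.sphere (0 : Sp ν) 1, w ∈ S.dom n → v ∈ S.coneOne w →
      R ≤ N (S.T^[n] w) (S.D n w v) := by
    refine (isCompact_sphere 0 1).eventually_forall_of_forall_eventually fun v hv => ?_
    by_cases hzv : (z, v) ∈ closure S.coneOneGraph
    · have hlt := h v (Or.inr ⟨hz, hzv⟩) (mem_sphere_zero_iff_norm.1 hv)
      have hcont := hnorm.continuousOn_iterate hS (n := n) (z, v)
        ⟨hzn, hS.mem_cone_of_mem_closure (hzn.2 0 hn) hzv⟩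
      filter_upwards [eventually_nhdsWithin_iff.1 (hcont.eventually_const_lt hlt)]
        with q hq hqdom hqv
      exact (hq ⟨hqdom, hS.coneOne_subset_cone (hqdom.2 0 hn) hqv⟩).le
    · filter_upwards [isClosed_closure.isOpen_compl.mem_nhds hzv] with q hq hqdom hqv
      exact absurd (hS.mem_closure_coneOneGraph hqdom.1 hqv) hq
  filter_upwards [hsphere] with w hw hwdom v hv
  exact hnorm.mul_norm_le_iterate_of_norm_eq_one hS hn hwdom
    (fun u hu hu1 => hw u (mem_sphere_zero_iff_norm.2 hu1) hwdom hu) hv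

lemma IsIncreasingNorm.exists_mem_expandingSet (hnorm : S.IsIncreasingNorm N)
    (hS : S.HasInvariantCones) (hz : z ∈ S.Sminus) (hdom : ∀ n, z ∈ S.dom n)
    (hexp : ∀ R : ℝ, ∀ᶠ n in atTop, ∀ v ∈ S.coneOne z, R * N z v ≤ N (S.T^[n] z) (S.D n z v))
    (hR : 0 < R) : ∃ m, z ∈ S.expandingSet N R m := by
  obtain ⟨a, ha, b, -, hab⟩ := hnorm.locally_equivalent z (hdom 0).1
  obtain ⟨m, hm, hm0⟩ := ((hexp (2 * R / a)).and (eventually_gt_atTop 0)).exists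
  have hlt : ∀ v ∈ S.coneOne z, ‖v‖ = 1 → R < N (S.T^[m] z) (S.D m z v) := fun v hv hv1 => by
    have hav := (hab.self_of_nhds v (hS.coneOne_subset_cone ((hdom m).2 0 hm0) hv)).1
    calc R < 2 * R := by linarith
      _ = 2 * R / a * (a * ‖v‖) := by rw [hv1, mul_one, div_mul_cancel₀ _ ha.ne']
      _ ≤ 2 * R / a * N z v := by gcongr
      _ ≤ _ := hm v hv
  refine ⟨m, mem_interior_iff_mem_nhds.2 ?_⟩
  filter_upwards [hnorm.eventually_mul_norm_le_iterate hS hz hm0 (hdom m) hlt]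
    with w hw n hn hwn v hv
  exact (hw (antitone_iterateDomain _ _ _ hn hwn) v hv).trans
    (hnorm.le_iterate hS hn hwn (hS.coneOne_subset_cone (hwn.2 0 (hm0.trans_le hn)) hv))

end SingularSystem

lemma exists_isClosed_forall_notMem_ball_subset {X : Type*} [PseudoMetricSpace X]
    [MeasurableSpace X] [OpensMeasurableSpace X] {π : Measure X} [IsFiniteMeasure π]
    {V : ℕ → Set X} (hV : ∀ m, IsOpen (V m)) (hmono : Monotone V) (hnull : π (⋃ m, V m)ᶜ = 0)
    {ε : ℝ≥0∞} (hε : 0 < ε) :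
    ∃ (m : ℕ) (F : Set X) (ρ : ℝ), IsClosed F ∧ 0 < ρ ∧ π F ≤ ε ∧
      ∀ y ∉ F, Metric.ball y ρ ⊆ V m := by
  have hlim := tendsto_measure_iInter_atTop (μ := π)
    (fun m => (hV m).measurableSet.compl.nullMeasurableSet)
    (fun _ _ hmn => compl_subset_compl.2 (hmono hmn)) ⟨0, measure_ne_top π _⟩
  rw [← compl_iUnion, hnull] at hlim
  obtain ⟨m, hm⟩ := (hlim.eventually_lt_const hε).exists
  have hthick := (tendsto_measure_cthickening_of_isClosed (μ := π)
    ⟨1, one_pos, measure_ne_top π _⟩ (hV m).isClosed_compl).mono_left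
      (nhdsWithin_le_nhds (s := Ioi 0))
  obtain ⟨ρ, hρ, hρ0⟩ := ((hthick.eventually_lt_const hm).and self_mem_nhdsWithin).exists
  refine ⟨m, _, ρ, Metric.isClosed_cthickening, hρ0, hρ.le, fun y hy x hx => ?_⟩
  by_contra hxm
  exact hy (Metric.mem_cthickening_of_dist_le y x ρ _ hxm (Metric.mem_ball'.1 hx).le)

namespace SingularSystem

lemma SinaiChernovAnsatz.measure_compl_iUnion_expandingSet {ν : ℕ} {S : SingularSystem ν}
    {N : Sp ν → Sp ν → ℝ} {R : ℝ} {π : Measure (Sp ν)} (hansatz : S.SinaiChernovAnsatz π N)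
    (hS : S.HasInvariantCones) (hnorm : S.IsIncreasingNorm N) (hπ : π S.Sminusᶜ = 0)
    (hR : 0 < R) : π (⋃ m, S.expandingSet N R m)ᶜ = 0 := by
  have hSminus : ∀ᵐ z ∂π, z ∈ S.Sminus := hπ
  filter_upwards [hSminus, hansatz] with z hz hexp
  exact mem_iUnion.2 (hnorm.exists_mem_expandingSet hS hz (hexp hz).1 (hexp hz).2 hR)

end SingularSystem

/-! ### Preimages of cut local unstable manifolds -/

namespace SingularSystem

variable {ν : ℕ} {S : SingularSystem ν} {N : Sp ν → Sp ν → ℝ} {i j n p : ℕ} {z₀ w y : Sp ν}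
  {σ : ℝ → Sp ν} {a b c r R κ δ t : ℝ}

namespace IsCutPreimage

lemma mem_dom_of_le (hσ : S.IsCutPreimage i δ σ w y) (hji : j ≤ i) (ht : t ∈ Icc (0 : ℝ) 1) :
    σ t ∈ S.dom j :=
  antitone_iterateDomain _ _ _ hji (hσ.mem_dom t ht)

lemma contDiffOn_iterate_comp (hσ : S.IsCutPreimage i δ σ w y) (hS : S.IsSmoothSystem)
    (hji : j ≤ i) : ContDiffOn ℝ 1 (S.T^[j] ∘ σ) (Icc 0 1) :=
  (contDiffOn_iterate hS.contDiffOn).comp hσ.contDiffOn fun _ ht => hσ.mem_dom_of_le hji ht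

lemma derivWithin_mem_cone (hσ : S.IsCutPreimage i δ σ w y) (hS : S.HasInvariantCones)
    (hi : 0 < i) (ht : t ∈ Icc (0 : ℝ) 1) : derivWithin σ (Icc 0 1) t ∈ S.cone (σ t) :=
  hS.coneOne_subset_cone ((hσ.mem_dom t ht).2 0 hi) (hσ.tangent t ht)

lemma nonneg (hσ : S.IsCutPreimage i δ σ w y) : 0 ≤ δ :=
  (arcLength_nonneg zero_le_one).trans hσ.arcLength_lt.le

end IsCutPreimage

lemma mem_ball_two_mul_of_arcLength_lt {E : Type*} [NormedAddCommGroup E] [NormedSpace ℝ E]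
    [CompleteSpace E] {γ : ℝ → E} {x : E} (hγ : ContDiffOn ℝ 1 γ (Icc 0 1))
    (h0 : γ 0 ∈ Metric.ball x r) (ht : t ∈ Icc (0 : ℝ) 1) (hr : arcLength γ 0 t < r) :
    γ t ∈ Metric.ball x (2 * r) := by
  have hdist := dist_le_arcLength hγ le_rfl ht.1 ht.2
  rw [dist_comm] at hdist
  exact Metric.mem_ball.2 ((dist_triangle _ (γ 0) _).trans_lt
    (by linarith [Metric.mem_ball.1 h0]))

namespace IsExpansionBall

lemma b_pos (hB : S.IsExpansionBall N z₀ r a b κ) : 0 < b :=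
  hB.a_pos.trans_le hB.a_le_b

lemma inv_pos (hB : S.IsExpansionBall N z₀ r a b κ) : 0 < κ⁻¹ :=
  _root_.inv_pos.2 (one_pos.trans hB.one_lt)

lemma inv_lt_one (hB : S.IsExpansionBall N z₀ r a b κ) : κ⁻¹ < 1 :=
  inv_lt_one_of_one_lt₀ hB.one_lt

lemma iterate_mem_ball_self (hB : S.IsExpansionBall N z₀ r a b κ)
    (hσ : S.IsCutPreimage i δ σ w y) (hS : S.IsSmoothSystem) (hw : S.T^[i] w ∈ Metric.ball z₀ r)
    (hδ : b / a * δ < r) (ht : t ∈ Icc (0 : ℝ) 1) :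
    S.T^[i] (σ t) ∈ Metric.ball z₀ (2 * r) := by
  have hC := hσ.contDiffOn_iterate_comp hS le_rfl
  refine mem_ball_two_mul_of_arcLength_lt (γ := S.T^[i] ∘ σ) hC (by simpa [hσ.start] using hw) ht ?_
  calc arcLength (S.T^[i] ∘ σ) 0 t ≤ arcLength (S.T^[i] ∘ σ) 0 1 :=
        arcLength_mono hC le_rfl le_rfl ht.1 ht.2 le_rfl
    _ ≤ δ := hσ.arcLength_lt.le
    _ ≤ b / a * δ := le_mul_of_one_le_left hσ.nonneg ((one_le_div hB.a_pos).2 hB.a_le_b)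
    _ < r := hδ

lemma norm_iterate_le (hB : S.IsExpansionBall N z₀ r a b κ) (hσ : S.IsCutPreimage i δ σ w y)
    (hS : S.HasInvariantCones) (hi : 0 < i) (hw : S.T^[i] w ∈ Metric.ball z₀ r)
    (hδ : b / a * δ < r) (ht : t ∈ Icc (0 : ℝ) 1) :
    N (S.T^[i] (σ t)) (S.D i (σ t) (derivWithin σ (Icc 0 1) t)) ≤
      b * ‖derivWithin (S.T^[i] ∘ σ) (Icc 0 1) t‖ := by
  have hdom := hσ.mem_dom t ht
  rw [hS.derivWithin_iterate_comp hσ.contDiffOn ht hdom]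
  exact hB.norm_le _ (hB.iterate_mem_ball_self hσ hS.toIsSmoothSystem hw hδ ht) _
    (hS.D_mem_cone hdom (hσ.derivWithin_mem_cone hS hi ht))

lemma iterate_mem_ball (hB : S.IsExpansionBall N z₀ r a b κ) (hσ : S.IsCutPreimage i δ σ w y)
    (hS : S.HasInvariantCones) (hnorm : S.IsIncreasingNorm N) (hi : 0 < i)
    (hw : S.T^[i] w ∈ Metric.ball z₀ r) (hδ : b / a * δ < r) (hji : j ≤ i)
    (hwj : S.T^[j] w ∈ Metric.ball z₀ r) (ht : t ∈ Icc (0 : ℝ) 1) :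
    S.T^[j] (σ t) ∈ Metric.ball z₀ (2 * r) := by
  have ha := hB.a_pos
  have hb := hB.b_pos
  have hC := hσ.contDiffOn_iterate_comp hS.toIsSmoothSystem hji
  have h0 : (S.T^[j] ∘ σ) 0 ∈ Metric.ball z₀ r := by simpa [hσ.start] using hwj
  have hlen : b / a * arcLength (S.T^[i] ∘ σ) 0 1 < r :=
    lt_of_le_of_lt (by gcongr; exact hσ.arcLength_lt.le) hδ
  have hbound := arcLength_le_of_forall_arcLength_right_lt hC
    (hσ.contDiffOn_iterate_comp hS.toIsSmoothSystem le_rfl) (by positivity) hlen fun t ht htr => by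
      have hcone := hσ.derivWithin_mem_cone hS hi ht
      have hdom := hσ.mem_dom_of_le hji ht
      rw [div_mul_eq_mul_div, le_div_iff₀' ha, hS.derivWithin_iterate_comp hσ.contDiffOn ht hdom]
      calc a * ‖S.D j (σ t) (derivWithin σ (Icc 0 1) t)‖
          ≤ N (S.T^[j] (σ t)) (S.D j (σ t) (derivWithin σ (Icc 0 1) t)) :=
            hB.le_norm _ (mem_ball_two_mul_of_arcLength_lt hC h0 ht htr) _
              (hS.D_mem_cone hdom hcone)
        _ ≤ N (S.T^[i] (σ t)) (S.D i (σ t) (derivWithin σ (Icc 0 1) t)) :=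
            hnorm.le_iterate hS hji (hσ.mem_dom t ht) hcone
        _ ≤ _ := hB.norm_iterate_le hσ hS hi hw hδ ht
  exact mem_ball_two_mul_of_arcLength_lt hC h0 ht
    ((arcLength_mono hC le_rfl le_rfl ht.1 ht.2 le_rfl).trans_lt (hbound.trans_lt hlen))

lemma norm_derivWithin_le (hB : S.IsExpansionBall N z₀ r a b κ) (hσ : S.IsCutPreimage i δ σ w y)
    (hS : S.HasInvariantCones) (hnorm : S.IsIncreasingNorm N) (hi : 0 < i)
    (hw : S.T^[i] w ∈ Metric.ball z₀ r) (hδ : b / a * δ < r) (hni : n ≤ i)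
    (hvis : visits S.T (Metric.ball z₀ r) p n w = 0) (hc : 0 < c) (ht : t ∈ Icc (0 : ℝ) 1)
    (hle : c * ‖derivWithin σ (Icc 0 1) t‖ ≤
      N (S.T^[n] (σ t)) (S.D n (σ t) (derivWithin σ (Icc 0 1) t))) :
    ‖derivWithin σ (Icc 0 1) t‖ ≤ b / c * κ⁻¹ ^ visits S.T (Metric.ball z₀ r) p i w *
      ‖derivWithin (S.T^[i] ∘ σ) (Icc 0 1) t‖ := by
  have hκ : 0 < κ ^ visits S.T (Metric.ball z₀ r) p i w := pow_pos (one_pos.trans hB.one_lt) _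
  have hexp := hnorm.pow_visits_mul_le hS hB.one_lt.le hB.factor hni hvis
    (fun j hj hwj => hB.iterate_mem_ball hσ hS hnorm hi hw hδ hj.le hwj ht) (hσ.mem_dom t ht)
    (hσ.derivWithin_mem_cone hS hi ht)
  have hchain : κ ^ visits S.T (Metric.ball z₀ r) p i w * (c * ‖derivWithin σ (Icc 0 1) t‖) ≤
      b * ‖derivWithin (S.T^[i] ∘ σ) (Icc 0 1) t‖ :=
    (mul_le_mul_of_nonneg_left hle hκ.le).trans
      (hexp.trans (hB.norm_iterate_le hσ hS hi hw hδ ht))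
  rw [← mul_assoc, ← le_div_iff₀' (by positivity)] at hchain
  refine hchain.trans_eq ?_
  rw [inv_pow]
  field_simp

lemma arcLength_le (hB : S.IsExpansionBall N z₀ r a b κ) (hσ : S.IsCutPreimage i δ σ w y)
    (hS : S.HasInvariantCones) (hnorm : S.IsIncreasingNorm N)
    (hw : S.T^[i] w ∈ Metric.ball z₀ r) (hδ : b / a * δ < r) (hp : 0 < p) (hpi : p ≤ i) :
    arcLength σ 0 1 ≤ b / a * δ * κ⁻¹ ^ visits S.T (Metric.ball z₀ r) p i w := by
  obtain ⟨n, hpn, hni, hwn, hvis⟩ := exists_visits_eq_zero hpi hw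
  have hi : 0 < i := hp.trans_le hpi
  have hq := hB.inv_pos.le
  have hba : 0 ≤ b / a := div_nonneg hB.b_pos.le hB.a_pos.le
  have hlen : b / a * κ⁻¹ ^ visits S.T (Metric.ball z₀ r) p i w *
      arcLength (S.T^[i] ∘ σ) 0 1 ≤ b / a * δ * κ⁻¹ ^ visits S.T (Metric.ball z₀ r) p i w := by
    rw [mul_right_comm]
    gcongr
    exact hσ.arcLength_lt.le
  have hlt : b / a * δ * κ⁻¹ ^ visits S.T (Metric.ball z₀ r) p i w < r :=
    (mul_le_of_le_one_right (mul_nonneg hba hσ.nonneg)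
      (pow_le_one₀ hq hB.inv_lt_one.le)).trans_lt hδ
  refine (arcLength_le_of_forall_arcLength_left_lt hσ.contDiffOn
    (hσ.contDiffOn_iterate_comp hS.toIsSmoothSystem le_rfl) (by positivity) (hlen.trans_lt hlt)
    fun t ht htr => ?_).trans hlen
  exact hB.norm_derivWithin_le hσ hS hnorm hi hw hδ hni hvis hB.a_pos ht
    (hB.le_norm_iterate _ (hσ.mem_tube hS hσ.mem_Sminus ht htr.le) n (hp.trans_le hpn)
      (hσ.mem_dom_of_le hni ht) (hB.iterate_mem_ball hσ hS hnorm hi hw hδ hni hwn ht) _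
      (hσ.tangent t ht))

lemma arcLength_le_of_forall_mem_expandingSet (hB : S.IsExpansionBall N z₀ r a b κ)
    (hσ : S.IsCutPreimage i δ σ w y) (hS : S.HasInvariantCones) (hnorm : S.IsIncreasingNorm N)
    (hw : S.T^[i] w ∈ Metric.ball z₀ r) (hδ : b / a * δ < r) (hp : 0 < p) (hpi : p ≤ i)
    (hR : 0 < R) (hexp : ∀ t ∈ Icc (0 : ℝ) 1, σ t ∈ S.expandingSet N R p) :
    arcLength σ 0 1 ≤ b / R * δ * κ⁻¹ ^ visits S.T (Metric.ball z₀ r) p i w := by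
  obtain ⟨n, hpn, hni, -, hvis⟩ := exists_visits_eq_zero hpi hw
  have hb := hB.b_pos
  have hq := hB.inv_pos
  refine (arcLength_le_mul_arcLength
    (c := b / R * κ⁻¹ ^ visits S.T (Metric.ball z₀ r) p i w) hσ.contDiffOn
    (hσ.contDiffOn_iterate_comp hS.toIsSmoothSystem le_rfl) le_rfl zero_le_one le_rfl
    (by positivity) fun t ht => ?_).trans ?_
  · exact hB.norm_derivWithin_le hσ hS hnorm (hp.trans_le hpi) hw hδ hni hvis hR ht
      (interior_subset (hexp t ht) n hpn (hσ.mem_dom_of_le hni ht) _ (hσ.tangent t ht))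
  · rw [mul_right_comm]
    gcongr
    exact hσ.arcLength_lt.le

end IsExpansionBall

end SingularSystem

/-! ### Measure of the points with a given number of visits -/

section VisitSet

variable {α : Type*} {f : α → α} {s M U : Set α} {p k m n : ℕ}

/-- The points in the domain of the `n`-th iterate whose orbit under the partial map is in `U` at
the time `n ≥ p`, after `k` visits to `U` at times in `[p, n)`. -/
def visitSet (f : α → α) (s M U : Set α) (p k n : ℕ) : Set α :=
  {x ∈ iterateDomain f s M n | (p ≤ n ∧ f^[n] x ∈ U) ∧ visits f U p n x = k}

lemma pairwise_disjoint_visitSet (f : α → α) (s M U : Set α) (p k : ℕ) :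
    Pairwise (Function.onFun Disjoint (visitSet f s M U p k)) := by
  classical
  exact fun _ _ hmn => disjoint_left.2 fun _ ⟨_, hm, hkm⟩ ⟨_, hn, hkn⟩ =>
    hmn (Nat.count_injective hm hn (hkm.trans hkn.symm))

lemma visits_eq_sum_indicator (f : α → α) (U : Set α) (p n : ℕ) (x : α) :
    visits f U p n x = ∑ j ∈ Finset.range n, {x | p ≤ j ∧ f^[j] x ∈ U}.indicator 1 x := by
  classical
  simp only [visits, Nat.count_eq_card_filter_range, Finset.card_filter, indicator_apply,
    mem_ofPred_eq, Pi.one_apply]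

variable [MeasurableSpace α] {μ : Measure α}

lemma measurableSet_visitSet [TopologicalSpace α] [OpensMeasurableSpace α] (hM : IsOpen M)
    (hs : IsOpen s) (hf : ContinuousOn f s) (hU : IsOpen U) (p k n : ℕ) :
    MeasurableSet (visitSet f s M U p k n) := by
  have hP : ∀ j ≤ n, MeasurableSet (iterateDomain f s M n ∩ {x | p ≤ j ∧ f^[j] x ∈ U}) :=
    fun j hj => by
      by_cases hpj : p ≤ j
      · simp only [hpj, true_and]
        exact (((continuousOn_iterate hf).mono
          (antitone_iterateDomain f s M hj)).isOpen_inter_preimage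
            (isOpen_iterateDomain hM hs hf) hU).measurableSet
      · simp [hpj]
  have hsum : Measurable fun x => ∑ j ∈ Finset.range n,
      (iterateDomain f s M n ∩ {x | p ≤ j ∧ f^[j] x ∈ U}).indicator (1 : α → ℕ) x :=
    Finset.measurable_fun_sum _ fun j hj =>
      measurable_one.indicator (hP j (Finset.mem_range.1 hj).le)
  convert (hP n le_rfl).inter (hsum (measurableSet_singleton k)) using 1
  ext x
  simp only [visitSet, visits_eq_sum_indicator, mem_inter_iff, mem_ofPred_eq, mem_preimage,
    mem_singleton_iff, ← and_assoc]
  refine and_congr_right fun hx => ?_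
  simp only [← indicator_indicator, indicator_of_mem hx.1.1]

lemma measure_iterate_image_le (hμ : ∀ A ⊆ s, μ (f '' A) ≤ μ A) {A : Set α}
    (hA : A ⊆ iterateDomain f s M n) : μ (f^[n] '' A) ≤ μ A := by
  induction n with
  | zero => simp
  | succ n ih =>
    rw [Function.iterate_succ', image_comp]
    exact (hμ _ (image_subset_iff.2 fun x hx => (hA hx).2 n n.lt_succ_self)).trans
      (ih (hA.trans (antitone_iterateDomain f s M n.le_succ)))

lemma tsum_measure_inter_le {ι : Type*} [Countable ι] {V : ι → Set α}
    (hV : ∀ i, MeasurableSet (V i)) (hdisj : Pairwise (Function.onFun Disjoint V)) (A : Set α) :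
    ∑' i, μ (A ∩ V i) ≤ μ A := by
  simp_rw [inter_comm A, ← Measure.restrict_apply (μ := μ) (s := A) (hV _)]
  rw [← measure_iUnion hdisj hV, ← Measure.restrict_apply_univ A]
  exact measure_mono (subset_univ _)

lemma measure_le_tsum_tsum_visitSet (hμ : ∀ A ⊆ s, μ (f '' A) ≤ μ A) {A : ℕ → Set α} {Z : Set α}
    (hZ : ∀ z ∈ Z, ∃ n ≥ m, ∃ k, ∃ x ∈ A k ∩ visitSet f s M U p k n, f^[n] x = z) :
    μ Z ≤ ∑' n, ∑' k, μ (A k ∩ visitSet f s M U p k (n + m)) := by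
  have hsub : Z ⊆ ⋃ n, ⋃ k, f^[n + m] '' (A k ∩ visitSet f s M U p k (n + m)) := fun z hz => by
    obtain ⟨n, hn, k, hx⟩ := hZ z hz
    obtain ⟨l, rfl⟩ := Nat.exists_eq_add_of_le' hn
    exact mem_iUnion₂.2 ⟨l, k, hx⟩
  refine (measure_mono hsub).trans ((measure_iUnion_le _).trans (ENNReal.tsum_le_tsum fun n =>
    (measure_iUnion_le _).trans (ENNReal.tsum_le_tsum fun k => ?_)))
  exact measure_iterate_image_le hμ fun x hx => hx.2.1

variable [TopologicalSpace α] [OpensMeasurableSpace α]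

lemma tsum_tsum_visitSet_le (hM : IsOpen M) (hs : IsOpen s) (hf : ContinuousOn f s)
    (hU : IsOpen U) (p : ℕ) (A : ℕ → Set α) :
    ∑' n, ∑' k, μ (A k ∩ visitSet f s M U p k n) ≤ ∑' k, μ (A k) := by
  rw [ENNReal.tsum_comm]
  exact ENNReal.tsum_le_tsum fun k => tsum_measure_inter_le
    (measurableSet_visitSet hM hs hf hU p k) (pairwise_disjoint_visitSet f s M U p k) (A k)

lemma measure_le_tsum_of_forall_mem_visitSet (hM : IsOpen M) (hs : IsOpen s)
    (hf : ContinuousOn f s) (hμ : ∀ A ⊆ s, μ (f '' A) ≤ μ A) (hU : IsOpen U) {A : ℕ → Set α}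
    {Z : Set α} (hZ : ∀ z ∈ Z, ∃ n, ∃ k, ∃ x ∈ A k ∩ visitSet f s M U p k n, f^[n] x = z) :
    μ Z ≤ ∑' k, μ (A k) :=
  (measure_le_tsum_tsum_visitSet (m := 0) hμ fun z hz =>
    (hZ z hz).imp fun n h => ⟨n.zero_le, h⟩).trans
      (tsum_tsum_visitSet_le hM hs hf hU p A)

lemma exists_forall_measure_le_of_forall_mem_visitSet (hM : IsOpen M) (hs : IsOpen s)
    (hf : ContinuousOn f s) (hμ : ∀ A ⊆ s, μ (f '' A) ≤ μ A) (hU : IsOpen U) (p : ℕ)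
    {A : ℕ → Set α} (hA : ∑' k, μ (A k) ≠ ∞) {ε : ℝ≥0∞} (hε : 0 < ε) :
    ∃ m, ∀ Z : Set α,
      (∀ z ∈ Z, ∃ n ≥ m, ∃ k, ∃ x ∈ A k ∩ visitSet f s M U p k n, f^[n] x = z) → μ Z ≤ ε := by
  have htail := ENNReal.tendsto_sum_nat_add _
    (ne_top_of_le_ne_top hA (tsum_tsum_visitSet_le (μ := μ) hM hs hf hU p A))
  obtain ⟨m, hm⟩ := (htail.eventually_lt_const hε).exists
  exact ⟨m, fun Z hZ => (measure_le_tsum_tsum_visitSet hμ hZ).trans hm.le⟩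

end VisitSet

/-! ### Invariance of the symplectic volume -/

lemma vec_two_eq_update {α : Type*} (u x x' : α) : ![u, x] = Function.update ![u, x'] 1 x := by
  ext i
  fin_cases i <;> rfl

namespace SingularSystem

variable {ν : ℕ} {S : SingularSystem ν} {z : Sp ν}

/-- The symplectic form at a point as a bilinear form, whose Gram matrix in the standard basis
defines the density of the symplectic volume. -/
noncomputable def formBilin (S : SingularSystem ν) (z : Sp ν) : LinearMap.BilinForm ℝ (Sp ν) :=
  LinearMap.mk₂ ℝ (fun u v => S.ω z ![u, v])
    (fun u u' v => (S.ω z).toAlternatingMap.map_vecCons_add ![v] u u')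
    (fun c u v => (S.ω z).toAlternatingMap.map_vecCons_smul ![v] c u)
    (fun u v v' => by
      rw [vec_two_eq_update u (v + v') 0, vec_two_eq_update u v 0, vec_two_eq_update u v' 0,
        ContinuousAlternatingMap.map_update_add])
    (fun c u v => by
      rw [vec_two_eq_update u (c • v) 0, vec_two_eq_update u v 0,
        ContinuousAlternatingMap.map_update_smul])

lemma volumeDensity_eq (S : SingularSystem ν) (z : Sp ν) :
    S.volumeDensity z = Real.sqrt |(LinearMap.BilinForm.toMatrix
      (EuclideanSpace.basisFun (Fin (2 * ν)) ℝ).toBasis (S.formBilin z)).det| := by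
  unfold volumeDensity
  congr 3

lemma MapCondition.abs_det_mul_volumeDensity (hmap : S.MapCondition) (hz : z ∈ S.T.source) :
    |(S.D 1 z).det| * S.volumeDensity (S.T z) = S.volumeDensity z := by
  have hcomp : (S.formBilin (S.T z)).comp (S.D 1 z : Sp ν →ₗ[ℝ] Sp ν)
      (S.D 1 z : Sp ν →ₗ[ℝ] Sp ν) = S.formBilin z := by
    ext u v
    exact hmap.symplectic z hz _ _
  rw [volumeDensity_eq, volumeDensity_eq, ← hcomp, LinearMap.BilinForm.toMatrix_comp
    (EuclideanSpace.basisFun (Fin (2 * ν)) ℝ).toBasis, Matrix.det_mul, Matrix.det_mul,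
    Matrix.det_transpose, LinearMap.det_toMatrix, ← ContinuousLinearMap.det, mul_right_comm,
    abs_mul, Real.sqrt_mul (abs_nonneg _), abs_mul_self, Real.sqrt_mul_self_eq_abs]

lemma measure_eq_setLIntegral (hM : MeasurableSet S.M) {A : Set (Sp ν)} (hA : A ⊆ S.M) :
    S.μ A = ∫⁻ z in A, ENNReal.ofReal (S.volumeDensity z) := by
  rw [μ, withDensity_apply', Measure.restrict_restrict' hM, inter_eq_self_of_subset_left hA]

lemma MapCondition.measure_image_le (hmap : S.MapCondition) (hS : S.IsSmoothSystem)
    {A : Set (Sp ν)} (hA : A ⊆ S.T.source) : S.μ (S.T '' A) ≤ S.μ A := by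
  set B := toMeasurable S.μ A ∩ S.T.source
  have hB : MeasurableSet B :=
    (measurableSet_toMeasurable _ _).inter S.T.open_source.measurableSet
  have hBs : B ⊆ S.T.source := inter_subset_right
  have hBM : B ⊆ S.M := hBs.trans hS.source_subset
  have hTB : S.T '' B ⊆ S.M := image_subset_iff.2 fun z hz =>
    hS.target_subset (S.T.map_source (hBs hz))
  have hderiv : ∀ z ∈ B, HasFDerivWithinAt S.T (S.D 1 z) B z := fun z hz =>
    (hS.hasFDerivAt_iterate (n := 1) (mem_iterateDomain_succ.2
      ⟨⟨hBM hz, by simp⟩, hBs hz⟩)).hasFDerivWithinAt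
  calc S.μ (S.T '' A) ≤ S.μ (S.T '' B) :=
        measure_mono (image_mono (subset_inter (subset_toMeasurable _ _) hA))
    _ = ∫⁻ z in S.T '' B, ENNReal.ofReal (S.volumeDensity z) :=
        measure_eq_setLIntegral hS.isOpen.measurableSet hTB
    _ = ∫⁻ z in B, ENNReal.ofReal |(S.D 1 z).det| * ENNReal.ofReal (S.volumeDensity (S.T z)) :=
        lintegral_image_eq_lintegral_abs_det_fderiv_mul volume hB hderiv (S.T.injOn.mono hBs) _
    _ = ∫⁻ z in B, ENNReal.ofReal (S.volumeDensity z) := by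
        refine setLIntegral_congr_fun hB fun z hz => ?_
        rw [← ENNReal.ofReal_mul (abs_nonneg _), hmap.abs_det_mul_volumeDensity (hBs hz)]
    _ = S.μ B := (measure_eq_setLIntegral hS.isOpen.measurableSet hBM).symm
    _ ≤ S.μ (toMeasurable S.μ A) := measure_mono inter_subset_left
    _ = S.μ A := measure_toMeasurable _

end SingularSystem

/-! ### The tail bound -/

lemma eventually_const_mul_lt {x y : ℝ} (hx : 0 < x) (hy : 0 < y) :
    ∀ᶠ t in 𝓝[>] (0 : ℝ), x * t < y := by
  filter_upwards [Ioo_mem_nhdsGT (div_pos hy hx)] with t ht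
  exact (lt_div_iff₀' hx).1 ht.2

lemma tsum_ofReal_mul_pow {c q : ℝ} (hc : 0 ≤ c) (hq0 : 0 ≤ q) (hq1 : q < 1) :
    ∑' k : ℕ, ENNReal.ofReal (c * q ^ k) = ENNReal.ofReal (c / (1 - q)) := by
  rw [← ENNReal.ofReal_tsum_of_nonneg (fun k => by positivity)
    ((summable_geometric_of_lt_one hq0 hq1).mul_left c), tsum_mul_left,
    tsum_geometric_of_lt_one hq0 hq1, div_eq_mul_inv]

namespace SingularSystem

variable {ν : ℕ} {S : SingularSystem ν} {N : Sp ν → Sp ν → ℝ} {π : Measure (Sp ν)} {m n p : ℕ}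
  {z z₀ : Sp ν} {F : Set (Sp ν)} {a b c q r x R κ δ ρ : ℝ}

lemma TubeCondition.eventually_tube_le (htube : S.TubeCondition π) (hF : IsClosed F)
    (hx : π.real F < x) :
    ∀ᶠ ε in 𝓝[>] (0 : ℝ), S.μ (S.tube (S.Sminus ∩ F) ε) ≤ ENNReal.ofReal (x * ε) := by
  have hFfin : π F ≠ ∞ := ne_top_of_le_ne_top htube.finite.ne (measure_mono (subset_univ F))
  filter_upwards [htube.tube_le F hF _ (sub_pos.2 hx)] with ε hε
  calc S.μ (S.tube (S.Sminus ∩ F) ε)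
      ≤ (π F + ENNReal.ofReal (x - π.real F)) * ENNReal.ofReal ε := by
        refine hε.trans ?_
        gcongr
        exact inter_subset_right
    _ = ENNReal.ofReal (x * ε) := by
        rw [← ofReal_measureReal hFfin, ← ENNReal.ofReal_add measureReal_nonneg (sub_pos.2 hx).le,
          add_sub_cancel, ← ENNReal.ofReal_mul (measureReal_nonneg.trans hx.le)]

lemma TubeCondition.eventually_tsum_tube_le (htube : S.TubeCondition π) (hF : IsClosed F)
    (hx : π.real F < x) (hc : 0 < c) (hq0 : 0 < q) (hq1 : q < 1) :
    ∀ᶠ δ in 𝓝[>] (0 : ℝ), ∑' k : ℕ, S.μ (S.tube (S.Sminus ∩ F) (c * δ * q ^ k)) ≤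
      ENNReal.ofReal (x * (c / (1 - q)) * δ) := by
  have hx0 : 0 ≤ x := measureReal_nonneg.trans hx.le
  obtain ⟨ε, hε, hsub⟩ := mem_nhdsGT_iff_exists_Ioo_subset.1 (htube.eventually_tube_le hF hx)
  filter_upwards [eventually_const_mul_lt hc hε, self_mem_nhdsWithin] with δ hδε (hδ : 0 < δ)
  have hterm : ∀ k : ℕ, S.μ (S.tube (S.Sminus ∩ F) (c * δ * q ^ k)) ≤
      ENNReal.ofReal (x * (c * δ) * q ^ k) := fun k => by
    rw [mul_assoc x]
    exact hsub ⟨by positivity, (mul_le_of_le_one_right (by positivity)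
      (pow_le_one₀ hq0.le hq1.le)).trans_lt hδε⟩
  refine (ENNReal.tsum_le_tsum hterm).trans_eq ?_
  rw [tsum_ofReal_mul_pow (by positivity) hq0.le hq1]
  congr 1
  ring

lemma cutSet_subset (U : Set (Sp ν)) (hmn : m ≤ n) {δ' : ℝ} (hδ : δ ≤ δ') :
    S.cutSet U n δ ⊆ S.cutSet U m δ' := by
  rintro z ⟨hz, W, hW, hcut⟩
  refine ⟨hz, W, hW, lt_of_le_of_lt ?_ (hcut.trans_le (ENNReal.ofReal_le_ofReal hδ))⟩
  refine le_iInf₂ fun γ hγ => iInf₂_le γ ⟨hγ.1, hγ.2.1, hγ.2.2.1, hγ.2.2.2.1, ?_⟩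
  exact biUnion_subset_biUnion_left (fun i hi => hmn.trans_lt hi) hγ.2.2.2.2

lemma IsCutPreimage.mem_visitSet {i : ℕ} {σ : ℝ → Sp ν} {w y : Sp ν}
    (hσ : S.IsCutPreimage i δ σ w y) {U : Set (Sp ν)} (hw : S.T^[i] w ∈ U) (hpi : p ≤ i) :
    w ∈ visitSet S.T S.T.source S.M U p (visits S.T U p i w) i :=
  ⟨hσ.start ▸ hσ.mem_dom 0 (left_mem_Icc.2 zero_le_one), ⟨hpi, hw⟩, rfl⟩

namespace IsExpansionBall

lemma exists_mem_tube_of_mem_cutSet (hB : S.IsExpansionBall N z₀ r a b κ)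
    (hS : S.HasInvariantCones) (hnorm : S.IsIncreasingNorm N) (hδ : b / a * δ < r) (hp : 0 < p)
    (hpm : p ≤ m) (hz : z ∈ S.cutSet (Metric.ball z₀ r) m δ) :
    ∃ n ≥ m, ∃ k, ∃ w ∈ S.tube S.Sminus (b / a * δ * κ⁻¹ ^ k) ∩
      visitSet S.T S.T.source S.M (Metric.ball z₀ r) p k n, S.T^[n] w = z := by
  obtain ⟨i, hi, σ, w, y, hσ, rfl⟩ := exists_isCutPreimage hS.toIsSmoothSystem hz
  have hpi : p ≤ i := hpm.trans hi.le
  refine ⟨i, hi.le, _, w, ⟨?_, hσ.mem_visitSet hz.1 hpi⟩, rfl⟩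
  rw [← hσ.start]
  exact hσ.mem_tube hS hσ.mem_Sminus (left_mem_Icc.2 zero_le_one)
    (hσ.start ▸ hB.arcLength_le hσ hS hnorm hz.1 hδ hp hpi)

lemma exists_mem_tube_union_of_mem_cutSet (hB : S.IsExpansionBall N z₀ r a b κ)
    (hS : S.HasInvariantCones) (hnorm : S.IsIncreasingNorm N) (hδ : b / a * δ < r) (hp : 0 < p)
    (hR : 0 < R) (hρ : b / a * δ < ρ)
    (hF : ∀ y ∉ F, Metric.ball y ρ ⊆ S.expandingSet N R p)
    (hz : z ∈ S.cutSet (Metric.ball z₀ r) p δ) :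
    ∃ n, ∃ k, ∃ w ∈ (S.tube (S.Sminus ∩ F) (b / a * δ * κ⁻¹ ^ k) ∪
      S.tube S.Sminus (b / R * δ * κ⁻¹ ^ k)) ∩
        visitSet S.T S.T.source S.M (Metric.ball z₀ r) p k n, S.T^[n] w = z := by
  obtain ⟨i, hi, σ, w, y, hσ, rfl⟩ := exists_isCutPreimage hS.toIsSmoothSystem hz
  have hlen := hB.arcLength_le hσ hS hnorm hz.1 hδ hp hi.le
  have h0 : (0 : ℝ) ∈ Icc (0 : ℝ) 1 := left_mem_Icc.2 zero_le_one
  refine ⟨i, _, w, ⟨?_, hσ.mem_visitSet hz.1 hi.le⟩, rfl⟩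
  by_cases hy : y ∈ F
  · exact Or.inl (hσ.start ▸ hσ.mem_tube hS (mem_inter hσ.mem_Sminus hy) h0 (hσ.start.symm ▸ hlen))
  have hlt : arcLength σ 0 1 < ρ := (hlen.trans (mul_le_of_le_one_right
    (mul_nonneg (div_nonneg hB.b_pos.le hB.a_pos.le) hσ.nonneg)
    (pow_le_one₀ hB.inv_pos.le hB.inv_lt_one.le))).trans_lt hρ
  have hexp : ∀ t ∈ Icc (0 : ℝ) 1, σ t ∈ S.expandingSet N R p := fun t ht => by
    refine hF y hy (Metric.mem_ball.2 ?_)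
    rw [← hσ.finish]
    exact ((dist_le_arcLength hσ.contDiffOn ht.1 ht.2 le_rfl).trans
      (arcLength_mono hσ.contDiffOn le_rfl ht.1 ht.2 le_rfl le_rfl)).trans_lt hlt
  have hshort := hB.arcLength_le_of_forall_mem_expandingSet hσ hS hnorm hz.1 hδ hp hi.le hR hexp
  exact Or.inr (hσ.start ▸ hσ.mem_tube hS hσ.mem_Sminus h0 (hσ.start.symm ▸ hshort))

lemma exists_measure_cutSet_le (hB : S.IsExpansionBall N z₀ r a b κ) (hS : S.HasInvariantCones)
    (hnorm : S.IsIncreasingNorm N) (hμ : ∀ A ⊆ S.T.source, S.μ (S.T '' A) ≤ S.μ A)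
    (hδ : b / a * δ < r) (hfin : ∑' k : ℕ, S.μ (S.tube S.Sminus (b / a * δ * κ⁻¹ ^ k)) ≠ ∞)
    {ε : ℝ≥0∞} (hε : 0 < ε) : ∃ m, S.μ (S.cutSet (Metric.ball z₀ r) m δ) ≤ ε := by
  obtain ⟨m, hm⟩ := exists_forall_measure_le_of_forall_mem_visitSet hS.isOpen S.T.open_source
    hS.contDiffOn.continuousOn hμ (Metric.isOpen_ball (x := z₀) (ε := r)) 1 hfin hε
  refine ⟨max m 1, hm _ fun z hz => ?_⟩
  obtain ⟨n, hn, hcut⟩ :=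
    hB.exists_mem_tube_of_mem_cutSet hS hnorm hδ one_pos (le_max_right m 1) hz
  exact ⟨n, (le_max_left m 1).trans hn, hcut⟩

lemma measure_cutSet_le_tsum_add_tsum (hB : S.IsExpansionBall N z₀ r a b κ)
    (hS : S.HasInvariantCones) (hnorm : S.IsIncreasingNorm N)
    (hμ : ∀ A ⊆ S.T.source, S.μ (S.T '' A) ≤ S.μ A) (hδ : b / a * δ < r) (hp : 0 < p)
    (hR : 0 < R) (hρ : b / a * δ < ρ)
    (hF : ∀ y ∉ F, Metric.ball y ρ ⊆ S.expandingSet N R p) :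
    S.μ (S.cutSet (Metric.ball z₀ r) p δ) ≤
      ∑' k : ℕ, S.μ (S.tube (S.Sminus ∩ F) (b / a * δ * κ⁻¹ ^ k)) +
        ∑' k : ℕ, S.μ (S.tube S.Sminus (b / R * δ * κ⁻¹ ^ k)) := by
  rw [← ENNReal.tsum_add]
  exact (measure_le_tsum_of_forall_mem_visitSet hS.isOpen S.T.open_source
    hS.contDiffOn.continuousOn hμ Metric.isOpen_ball fun z hz =>
      hB.exists_mem_tube_union_of_mem_cutSet hS hnorm hδ hp hR hρ hF hz).trans
        (ENNReal.tsum_le_tsum fun k => measure_union_le _ _)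

lemma exists_eventually_measure_cutSet_le_add (hB : S.IsExpansionBall N z₀ r a b κ)
    (hS : S.HasInvariantCones) (hnorm : S.IsIncreasingNorm N)
    (hμ : ∀ A ⊆ S.T.source, S.μ (S.T '' A) ≤ S.μ A) (htube : S.TubeCondition π)
    (hansatz : S.SinaiChernovAnsatz π N) (hx : 0 < x) (hR : 0 < R) :
    ∃ m, ∀ᶠ δ in 𝓝[>] (0 : ℝ), S.μ (S.cutSet (Metric.ball z₀ r) m δ) ≤
      ENNReal.ofReal (x * (b / a / (1 - κ⁻¹)) * δ) +
        ENNReal.ofReal ((π.real univ + 1) * (b / R / (1 - κ⁻¹)) * δ) := by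
  have : IsFiniteMeasure π := ⟨htube.finite⟩
  have hba : 0 < b / a := div_pos hB.b_pos hB.a_pos
  obtain ⟨m, F, ρ, hF, hρ, hπF, hball⟩ := exists_isClosed_forall_notMem_ball_subset (π := π)
    (fun m => isOpen_interior) (monotone_expandingSet S N R)
    (hansatz.measure_compl_iUnion_expandingSet hS hnorm htube.supported hR)
    (ENNReal.ofReal_pos.2 (half_pos hx))
  have hFx : π.real F < x :=
    (ENNReal.toReal_le_of_le_ofReal (half_pos hx).le hπF).trans_lt (half_lt_self hx)
  have hclose := htube.eventually_tsum_tube_le hF hFx hba hB.inv_pos hB.inv_lt_one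
  have hfar := htube.eventually_tsum_tube_le isClosed_univ (lt_add_one _) (div_pos hB.b_pos hR)
    hB.inv_pos hB.inv_lt_one
  simp only [inter_univ] at hfar
  refine ⟨m + 1, ?_⟩
  filter_upwards [hclose, hfar, eventually_const_mul_lt hba hB.r_pos,
    eventually_const_mul_lt hba hρ] with δ h₁ h₂ hδr hδρ
  exact (hB.measure_cutSet_le_tsum_add_tsum hS hnorm hμ hδr m.succ_pos hR hδρ fun y hy =>
    (hball y hy).trans (monotone_expandingSet S N R m.le_succ)).trans (add_le_add h₁ h₂)

lemma exists_eventually_measure_cutSet_le_mul (hB : S.IsExpansionBall N z₀ r a b κ)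
    (hS : S.HasInvariantCones) (hnorm : S.IsIncreasingNorm N)
    (hμ : ∀ A ⊆ S.T.source, S.μ (S.T '' A) ≤ S.μ A) (htube : S.TubeCondition π)
    (hansatz : S.SinaiChernovAnsatz π N) {η : ℝ} (hη : 0 < η) :
    ∃ m, ∀ᶠ δ in 𝓝[>] (0 : ℝ),
      S.μ (S.cutSet (Metric.ball z₀ r) m δ) ≤ ENNReal.ofReal (η * δ) := by
  have ha := hB.a_pos
  have hb := hB.b_pos
  have hq : 0 < 1 - κ⁻¹ := sub_pos.2 hB.inv_lt_one
  have : 0 < π.real univ + 1 := add_pos_of_nonneg_of_pos measureReal_nonneg one_pos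
  obtain ⟨x, hx, hxη⟩ : ∃ x > 0, x * (b / a / (1 - κ⁻¹)) = η / 2 :=
    ⟨η / 2 / (b / a / (1 - κ⁻¹)), by positivity, div_mul_cancel₀ _ (by positivity)⟩
  obtain ⟨R, hR, hRη⟩ : ∃ R > 0, (π.real univ + 1) * (b / R / (1 - κ⁻¹)) = η / 2 := by
    refine ⟨(π.real univ + 1) * b / (η / 2 * (1 - κ⁻¹)), by positivity, ?_⟩
    generalize 1 - κ⁻¹ = s at hq
    field_simp
  obtain ⟨m, hm⟩ :=
    hB.exists_eventually_measure_cutSet_le_add hS hnorm hμ htube hansatz hx hR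
  refine ⟨m, ?_⟩
  filter_upwards [hm, self_mem_nhdsWithin] with δ hle (hδ : 0 < δ)
  rwa [hxη, hRη, ← ENNReal.ofReal_add (by positivity) (by positivity), ← add_mul,
    add_halves] at hle

lemma eventually_tsum_tube_ne_top (hB : S.IsExpansionBall N z₀ r a b κ)
    (htube : S.TubeCondition π) :
    ∀ᶠ δ in 𝓝[>] (0 : ℝ), ∑' k : ℕ, S.μ (S.tube S.Sminus (b / a * δ * κ⁻¹ ^ k)) ≠ ∞ := by
  have hle := htube.eventually_tsum_tube_le isClosed_univ (lt_add_one _)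
    (div_pos hB.b_pos hB.a_pos) hB.inv_pos hB.inv_lt_one
  simp only [inter_univ] at hle
  exact hle.mono fun δ hδ => ne_top_of_le_ne_top ENNReal.ofReal_ne_top hδ

end IsExpansionBall

end SingularSystem

theorem mainTheorem7_general {ν : ℕ} {S : SingularSystem ν} {π : Measure (Sp ν)}
    {N : Sp ν → Sp ν → ℝ} (hS : S.HasInvariantCones)
    (hμ : ∀ A ⊆ S.T.source, S.μ (S.T '' A) ≤ S.μ A) (htube : S.TubeCondition π)
    (hnc : S.NonContractionCondition) (hnorm : S.IsIncreasingNorm N)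
    (hansatz : S.SinaiChernovAnsatz π N) :
    ∀ z₀ ∈ S.M, ∃ U ∈ 𝓝 z₀, ∃ δ₀ : ℝ, 0 < δ₀ ∧ ∀ η : ℝ, 0 < η → ∃ m : ℕ,
      ∀ δ : ℝ, 0 < δ → δ ≤ δ₀ → S.μ (S.cutSet U m δ) ≤ ENNReal.ofReal (η * δ) := by
  intro z₀ hz₀
  obtain ⟨r, a, b, κ, hB⟩ := SingularSystem.exists_isExpansionBall hS hnc hnorm hz₀
  obtain ⟨δ₀, ⟨hfin, hδr⟩, hδ₀⟩ := (((hB.eventually_tsum_tube_ne_top htube).and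
    (eventually_const_mul_lt (div_pos hB.b_pos hB.a_pos) hB.r_pos)).and self_mem_nhdsWithin).exists
  refine ⟨Metric.ball z₀ r, Metric.ball_mem_nhds z₀ hB.r_pos, δ₀, hδ₀, fun η hη => ?_⟩
  obtain ⟨m₁, hsmall⟩ := hB.exists_eventually_measure_cutSet_le_mul hS hnorm hμ htube hansatz hη
  obtain ⟨δ₁, hδ₁, hsmall⟩ := mem_nhdsGT_iff_exists_Ioo_subset.1 hsmall
  obtain ⟨m₂, hlarge⟩ := hB.exists_measure_cutSet_le hS hnorm hμ hδr hfin
    (ENNReal.ofReal_pos.2 (mul_pos hη hδ₁))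
  refine ⟨max m₁ m₂, fun δ hδ hδle => ?_⟩
  rcases lt_or_ge δ δ₁ with hlt | hge
  · exact (measure_mono (SingularSystem.cutSet_subset _ (le_max_left m₁ m₂) le_rfl)).trans
      (hsmall ⟨hδ, hlt⟩)
  · calc S.μ (S.cutSet (Metric.ball z₀ r) (max m₁ m₂) δ)
        ≤ S.μ (S.cutSet (Metric.ball z₀ r) m₂ δ₀) :=
          measure_mono (SingularSystem.cutSet_subset _ (le_max_right m₁ m₂) hδle)
      _ ≤ ENNReal.ofReal (η * δ₁) := hlarge
      _ ≤ ENNReal.ofReal (η * δ) := by gcongr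

theorem mainTheorem7 {ν : ℕ} (S : SingularSystem ν) (π : Measure (Sp ν)) (N : Sp ν → Sp ν → ℝ)
    (hphase : S.PhaseSpaceCondition) (hmap : S.MapCondition) (hcone : S.ConeCondition)
    (hreg : S.RegularityCondition) (htube : S.TubeCondition π) (halign : S.AlignmentCondition)
    (hnc : S.NonContractionCondition) (hnorm : S.IsIncreasingNorm N)
    (hansatz : S.SinaiChernovAnsatz π N) :
    ∀ z₀ ∈ S.M, ∃ U ∈ 𝓝 z₀, ∃ δ₀ : ℝ, 0 < δ₀ ∧ ∀ η : ℝ, 0 < η → ∃ m : ℕ,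
      ∀ δ : ℝ, 0 < δ → δ ≤ δ₀ →
        S.μ {z ∈ U | ∃ W, S.IsLocalUnstableManifold z W ∧
          radiusCutBy z W (⋃ i > m, S.imageSminus i) < ENNReal.ofReal δ}
        ≤ ENNReal.ofReal (η * δ) :=
  have hS := hphase.hasInvariantCones hmap hcone
  mainTheorem7_general hS (fun _ => hmap.measure_image_le hS.toIsSmoothSystem) htube hnc hnorm
    hansatz
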